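/- **Setting.** Let $r\ge 1$ be an integer and let $\sigma,\tau,\mu\in\mathbb C$ have positive imaginary part. Write $e(z)=e^{2\pi i z}$, $(z;q)_\infty=\prod_{j\ge0}(1-zq^j)$, $\theta(z|q)=(z;q)_\infty(q/z;q)_\infty$. For $z\in\mathbb C$, $s\in\mathbb Z$ put $$\theta_\sigma(z,s)=e^{\phi_\sigma(z,s)}\,\theta\big(e(z+\sigma s)\,|\,e(r\sigma)\big),\qquad \theta_\sigma(z,s)_k=\prod_{j=0}^{k-1}\theta_\sigma(z+j\tau,s+j),$$ $$\phi_\sigma(z,s)=-\tfrac{\pi i}{6r}\big(3(r-1-2s)(2z-1)-(r^2-1)(\sigma-\tau-1)+6s(r-s)(\sigma-1)\big),$$ $$\Gamma(z,s)=e^{\phi_e(z,s)}\prod_{j,k\ge0}\frac{1-e(-z-\sigma s+(\sigma+\tau)(j+1)+\sigma r(k+1))}{1-e(z+\sigma s+(\sigma+\tau)j+\sigma rk)}\prod_{j,k\ge0}\frac{1-e(-z-\tau(r-s)+(\sigma+\tau)(j+1)+\tau r(k+1))}{1-e(z+\tau(r-s)+(\sigma+\tau)j+\tau rk)},$$ $$\phi_e(z,s)=\tfrac{\pi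 i}{6r}\,s(s-r)\big(6z-3\sigma-3\tau+(1-\sigma+\tau)(r-2s)\big).$$ Let $B_{4,4}(z;\omega_1,\dots,\omega_4)$ be the coefficient of $x^4/4!$ in $x^4e^{zx}/\prod_{j=1}^4(e^{\omega_jx}-1)$, and put $S(z;\sigma,\tau,\omega)=\frac1{48}\big(B_{4,4}(z;\sigma,\tau,-1,\omega)+B_{4,4}(z-1;\sigma,\tau,-1,\omega)\big)$, $S_2(z,s;\sigma,\tau,\omega)=S(z+s\sigma;r\sigma,\sigma+\tau,\omega+\sigma)+S(z+(r-s)\tau;r\tau,\sigma+\tau,\omega-\tau)$, $T_2(z,s;\sigma,\tau,\omega)=S(z+s\sigma;r\sigma,\sigma+\tau,\omega)+S(z+(r-s)\tau;r\tau,\sigma+\tau,\omega)$, $\phi^+(z,s;\omega)=2\pi i\big(T_2(z,0;\sigma-\frac12,\tau+\frac12,\omega)-S_2(z,s;\sigma-\frac12,\tau+\frac12,\omega)\big)$, $g_\sigma(z,s;\omega)=\prod_{k_1,k_2,k_3\ge0}\big(1-e(z+\sigma s+\sigma rk_1+(\sigma+\tau)k_2+(\sigma+\omega)k_3)\big)$,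 $g_\tau(z,s;\omega)=\prod_{k_1,k_2,k_3\ge0}\big(1-e(z+\tau(r-s)+\tau rk_1+(\sigma+\tau)k_2+\omega k_3)\big)$, $$\Gamma^+_\sigma(z,s)=e^{\phi^+(z,s;\tau)}g_\sigma(z,s;\tau)\,g_\sigma(\sigma+2\tau-z,r+1-s;\tau),\qquad \gamma^+_\tau(z,s)=g_\tau(z,s;\mu)\,g_\tau(\sigma+\tau+\mu-z,r-s;\mu).$$ Let $v_0,\dots,v_7$ be the standard basis of $\mathbb C^8$, and let $Q(E_8)$ be the $\mathbb Z$-span of all $\pm v_i\pm v_j$ $(i<j)$ and all $\frac12(\pm v_0\pm\dots\pm v_7)$ with an even number of minus signs. For $n\in\mathbb Z$ let $D_n$ be the set of $X=(x,\mathbf x)\in\mathbb C^8\times Q(E_8)$ with $\sum_ix_i=2(n\tau+\sigma)$ and $\sum_i\mathbf x_i=2(n+r-1)$. For a vector $v$ write $X+vT=(x+v\tau,\mathbf x+v)$. Put $\tilde X=(\tilde x,\tilde{\mathbf x})$ with $\tilde x_i=x_i+\frac{\sigma+\tau}2-\frac12\sum_jx_j$, $\tilde{\mathbf x}_i=\mathbf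 x_i+\frac r2-\frac12\sum_j\mathbf x_j$, where $j$ runs over $\{0,1,2,3\}$ if $i\le3$ and over $\{4,5,6,7\}$ if $i\ge4$. Put $\lambda=(e(r\sigma);e(r\sigma))_\infty(e(r\tau);e(r\tau))_\infty$, and for $\mathbf x\in\mathbb Z^8\cup(\mathbb Z+\frac12)^8$ and $k\in\mathbb Z$ put $k_{\mathbf x}=k+(r+((r+1)\bmod2))(\mathbf x_1\bmod1)$. With products taken over all choices of signs (matched in the two arguments), let $$\Delta(z,s;x,\mathbf x)=\frac{\prod_{j=0}^7\Gamma(x_j\pm z,\mathbf x_j\pm s)}{\Gamma(\pm2z,\pm2s)},\qquad I(x,\mathbf x)=\frac\lambda2\sum_{k=0}^{r-1}\int_C\Delta(z,k_{\mathbf x};x,\mathbf x)\,dz.$$ Here $C$ is a piecewise $C^1$ contour from $0$ to $1$ that is *admissible* for $(x,\mathbf x)$: for all $j$ and all $0\le k<r$, the poles of $z\mapsto\Gamma(x_j-z,\mathbf x_j-k_{\mathbf x})$ lie above the $1$-periodic extension of $C$, and those of $z\mapsto\Gamma(x_j+z,\mathbf x_j+k_{\mathbf x})$ lie below it. If $\operatorname{Im}x_j>0$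 for all $j$, then $C=[0,1]$ is admissible. For $n\ge0$ put $\psi(X)=I(\tilde x,\tilde{\mathbf x})$ and $\psi^{(n)}_{ij}(X)=\psi(X+v^{(n)}_{ij}T)$, where $v^{(n)}_{ij}=(1-n)a_0+(n+1-i-j)a_1+(j-i)a_2$ and $a_0=\frac12(v_0+v_1+v_2+v_3)$, $a_1=\frac12(v_0+v_1-v_2-v_3)$, $a_2=\frac12(v_0-v_1+v_2-v_3)$. Let $$\mathscr G^{(n)}(X)=\prod_{0\le i\le3,\;4\le j\le7}\Gamma^+_\sigma\big((1-n)\tau+x_i+x_j,1-n+\mathbf x_i+\mathbf x_j\big)\,\gamma^+_\tau(x_i+x_j,\mathbf x_i+\mathbf x_j)^n$$ $$\qquad\times\prod_{0\le i<j\le3\text{ or }4\le i<j\le7}\Gamma^+_\sigma\big(\tau+x_i+x_j,1+\mathbf x_i+\mathbf x_j\big)\,\gamma^+_\tau(x_i+x_j+\mu,\mathbf x_i+\mathbf x_j)^n,$$ $$e^{(n)}(X)=e^{\frac{2\pi i}r(\sigma+1)\binom n2}\exp\Big(-n\,\tfrac{2\pi i}r\big(\tfrac1{2\tau}\textstyle\sum_ix_i^2-\tfrac12\sum_i\mathbf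 x_i^2\big)\Big),$$ $$d^{(n)}(X)=e^{\frac{4\pi i}r(\tau-1)\binom n3}e^{\frac{2\pi i}r(\sigma+\tau-x_0-x_1+\mathbf x_0+\mathbf x_1)\binom n2}\prod_{k=1}^n\Big[\theta_\sigma(x_0+x_3+(1-n)\tau,\mathbf x_0+\mathbf x_3+1-n)_{k-1}$$ $$\times\theta_\sigma(x_1+x_2+(1-n)\tau,\mathbf x_1+\mathbf x_2+1-n)_{k-1}\,\theta_\sigma(x_0-x_3-(k-1)\tau,\mathbf x_0-\mathbf x_3-(k-1))_{n-k}\,\theta_\sigma(x_1-x_2-(k-1)\tau,\mathbf x_1-\mathbf x_2-(k-1))_{n-k}\Big],$$ $$g^{(n)}(X)=\frac{e^{(n)}(X)}{d^{(n)}(X)}\,\mathscr G^{(n)}(X),\qquad \tau^{(n)}(X)=g^{(n)}(X)\det\big(\psi^{(n)}_{ij}(X)\big)_{i,j=1}^n.$$ **Theorem.** Let $n\ge0$, let $X=(x,\mathbf x)\in D_n$ with $d^{(n)}(X)\ne0$, and let $C$ be admissible for $\tilde X$. Then, for $1\le i,j\le n$, the point $X+v^{(n)}_{ij}T$ lies in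 $D_1$ and $C$ is admissible for its transform $(X+v^{(n)}_{ij}T)^{\sim}$; and with all integrals taken along $C$, $$\tau^{(n)}(X)=g^{(n)}(X)\,d^{(n)}(X)\,I_n(X)=e^{(n)}(X)\,\mathscr G^{(n)}(X)\,I_n(X),$$ where, with $\hat k_i=(k_i)_{\tilde{\mathbf x}}$, $$I_n(X)=\frac{\lambda^n}{2^n\,n!}\sum_{k_1,\dots,k_n=0}^{r-1}\int_{C^n}\prod_{1\le i<j\le n}\theta_\sigma(\pm z_i\pm z_j,\pm\hat k_i\pm\hat k_j)\prod_{i=1}^n\Delta(z_i,\hat k_i;\tilde x,\tilde{\mathbf x})\,dz_i .$$ In particular, if $\operatorname{Im}\tilde x_j>0$ for all $j$, one may take $C=[0,1]$. -/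

import Mathlib

open scoped BigOperators

noncomputable section

namespace LensTau

/-!
Throughout, `r` is a positive integer and `σ`, `τ`, `ω`, `μ` are points of the upper half plane.
A discrete variable is a rational number (an integer or a half-integer in all uses); the functions
`lensTheta`, `lensGamma`, `tripleGamma` are evaluated only where their discrete argument is an
integer.
-/

/-- `e(z) = exp(2πiz)`. -/
def e (z : ℂ) : ℂ := Complex.exp (2 * Real.pi * Complex.I * z)

/-- The infinite `q`-shifted factorial `(z; q)_∞`. -/
def qPoch (z q : ℂ) : ℂ := ∏' j : ℕ, (1 - z * q ^ j)

/-- The theta function `θ(z | q) = (z; q)_∞ (q / z; q)_∞`. -/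
def theta (z q : ℂ) : ℂ := qPoch z q * qPoch (q * z⁻¹) q

/-! ### Lens theta function -/

/-- The normalisation exponent `φ_σ(z, s; σ, τ)`. -/
def phiSigma (r : ℕ) (σ τ z : ℂ) (s : ℚ) : ℂ :=
  -(Real.pi * Complex.I) / (6 * r) *
    (3 * (r - 1 - 2 * s) * (2 * z - 1) - ((r : ℂ) ^ 2 - 1) * (σ - τ - 1)
      + 6 * s * (r - s) * (σ - 1))

/-- The lens theta function `θ_σ(z, s)`. -/
def lensTheta (r : ℕ) (σ τ z : ℂ) (s : ℚ) : ℂ :=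
  Complex.exp (phiSigma r σ τ z s) * theta (e z * e (σ * s)) (e (σ * r))

/-- `θ_σ(z, s)_k = ∏_{j=0}^{k-1} θ_σ(z + jτ, s + j)`. -/
def lensThetaPoch (r : ℕ) (σ τ z : ℂ) (s : ℚ) (k : ℕ) : ℂ :=
  ∏ j ∈ Finset.range k, lensTheta r σ τ (z + j * τ) (s + j)

/-! ### Lens elliptic gamma function -/

/-- The normalisation exponent `φ_e(z, s; σ, τ)`. -/
def phiE (r : ℕ) (σ τ z : ℂ) (s : ℚ) : ℂ :=
  Real.pi * Complex.I *
    (s * (s - r) * (6 * z - 3 * σ - 3 * τ + (1 - σ + τ) * (r - 2 * s))) / (6 * r)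

/-- The double product `γ_σ(z, s; σ, τ)`. -/
def gammaSigma (r : ℕ) (σ τ z : ℂ) (s : ℚ) : ℂ :=
  ∏' p : ℕ × ℕ,
    (1 - e (-z) * e (-(σ * s)) * e ((σ + τ) * (p.1 + 1)) * e (σ * r * (p.2 + 1))) /
    (1 - e z * e (σ * s) * e ((σ + τ) * p.1) * e (σ * r * p.2))

/-- The double product `γ_τ(z, s; σ, τ)`. -/
def gammaTau (r : ℕ) (σ τ z : ℂ) (s : ℚ) : ℂ :=
  ∏' p : ℕ × ℕ,
    (1 - e (-z) * e (-(τ * (r - s))) * e ((σ + τ) * (p.1 + 1)) * e (τ * r * (p.2 + 1))) /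
    (1 - e z * e (τ * (r - s)) * e ((σ + τ) * p.1) * e (τ * r * p.2))

/-- The lens elliptic gamma function `Γ(z, s; σ, τ)`. -/
def lensGamma (r : ℕ) (σ τ z : ℂ) (s : ℚ) : ℂ :=
  Complex.exp (phiE r σ τ z s) * gammaSigma r σ τ z s * gammaTau r σ τ z s

/-- `p` is a pole of `z ↦ Γ(z, s)` for an integer `s`. Since `Γ(z, s)` is `r`-periodic in `s`, `s`
may be replaced by its residue `ρ ∈ {0, …, r - 1}`; for that value no zero of the numerators in
`γ_σ γ_τ` meets a zero of the denominators, and the poles are the zeros of the denominators. -/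
def IsGammaPole (r : ℕ) (σ τ : ℂ) (s : ℚ) (p : ℂ) : Prop :=
  ∃ (j k : ℕ) (l : ℤ),
    p = l - (σ * ((⌊s⌋ % (r : ℤ) : ℤ) : ℂ) + (σ + τ) * j + σ * r * k) ∨
    p = l - (τ * (r - ((⌊s⌋ % (r : ℤ) : ℤ) : ℂ)) + (σ + τ) * j + τ * r * k)

/-! ### Lens triple gamma function -/

/-- The multiple Bernoulli polynomial `B_{4,4}(z; ω₁, …, ω₄)`: `4!` times the coefficient of `x⁴` in
`x⁴ exp(zx) / ∏ (exp(ω_j x) - 1)`, where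
`(exp(ω x) - 1) / x = ∑ ω^(k+1) / (k+1)! x^k`. -/
def bernoulli44 (z : ℂ) (w : Fin 4 → ℂ) : ℂ :=
  (Nat.factorial 4 : ℂ) * PowerSeries.coeff 4
    ((PowerSeries.mk fun k => z ^ k / (Nat.factorial k : ℂ)) *
      ∏ j, (PowerSeries.mk fun k => w j ^ (k + 1) / (Nat.factorial (k + 1) : ℂ))⁻¹)

/-- `S(z; σ, τ, ω)`. -/
def S (z σ τ ω : ℂ) : ℂ :=
  (bernoulli44 z ![σ, τ, -1, ω] + bernoulli44 (z - 1) ![σ, τ, -1, ω]) / 48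

/-- `S₂(z, s; σ, τ, ω)`. -/
def S2 (r : ℕ) (σ τ ω z : ℂ) (s : ℚ) : ℂ :=
  S (z + s * σ) (r * σ) (σ + τ) (ω + σ) + S (z + (r - s) * τ) (r * τ) (σ + τ) (ω - τ)

/-- `T₂(z, s; σ, τ, ω)`. -/
def T2 (r : ℕ) (σ τ ω z : ℂ) (s : ℚ) : ℂ :=
  S (z + s * σ) (r * σ) (σ + τ) ω + S (z + (r - s) * τ) (r * τ) (σ + τ) ω

/-- The normalisation exponent `φ⁺(z, s; σ, τ, ω)`. -/
def phiPlus (r : ℕ) (σ τ ω z : ℂ) (s : ℚ) : ℂ :=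
  2 * Real.pi * Complex.I *
    (T2 r (σ - 1 / 2) (τ + 1 / 2) ω z 0 - S2 r (σ - 1 / 2) (τ + 1 / 2) ω z s)

/-- The triple product `g_σ(z, s; σ, τ, ω)`. -/
def gSigma (r : ℕ) (σ τ ω z : ℂ) (s : ℚ) : ℂ :=
  ∏' k : ℕ × ℕ × ℕ,
    (1 - e z * e (σ * s) * e (σ * r * k.1) * e ((σ + τ) * k.2.1) * e ((σ + ω) * k.2.2))

/-- The triple product `g_τ(z, s; σ, τ, ω)`. -/
def gTau (r : ℕ) (σ τ ω z : ℂ) (s : ℚ) : ℂ :=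
  ∏' k : ℕ × ℕ × ℕ,
    (1 - e z * e (τ * (r - s)) * e (τ * r * k.1) * e ((σ + τ) * k.2.1) * e (ω * k.2.2))

/-- `γ⁺_σ(z, s; σ, τ, ω)`. -/
def gammaPlusSigma (r : ℕ) (σ τ ω z : ℂ) (s : ℚ) : ℂ :=
  gSigma r σ τ ω z s * gSigma r σ τ ω (σ + τ + ω - z) (r + 1 - s)

/-- `γ⁺_τ(z, s; σ, τ, ω)`. -/
def gammaPlusTau (r : ℕ) (σ τ ω z : ℂ) (s : ℚ) : ℂ :=
  gTau r σ τ ω z s * gTau r σ τ ω (σ + τ + ω - z) (r - s)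

/-- The lens triple gamma function `Γ⁺_σ(z, s; σ, τ, ω)`. -/
def tripleGamma (r : ℕ) (σ τ ω z : ℂ) (s : ℚ) : ℂ :=
  Complex.exp (phiPlus r σ τ ω z s) * gammaPlusSigma r σ τ ω z s

/-! ### The `E₈` lattice and the domains `D_n` -/

/-- The root lattice `Q(E₈)`: the `ℤ`-span of `±v_i ± v_j` (`i < j`) and of
`½(±v_0 ± ⋯ ± v_7)` with an even number of minus signs. -/
def latticeE8 : Submodule ℤ (Fin 8 → ℚ) :=
  Submodule.span ℤ
    ({v | ∃ (i j : Fin 8) (ε δ : ℤˣ), i < j ∧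
        v = Pi.single i (((ε : ℤ)) : ℚ) + Pi.single j (((δ : ℤ)) : ℚ)} ∪
     {v | ∃ ε : Fin 8 → ℤˣ, Even (Finset.univ.filter fun i => ε i = -1).card ∧
        v = fun i => (((ε i : ℤ)) : ℚ) / 2})

/-- Pairs `X = (x, 𝐱)` of continuous and discrete variables. -/
abbrev Point : Type := (Fin 8 → ℂ) × (Fin 8 → ℚ)

/-- `D_n = H_{nτ+σ} × (H_{n+r-1} ∩ Q(E₈))`, with `H_κ = {x | (x|φ) = κ}`,
`φ = ½(v_0 + ⋯ + v_7)`. -/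
def domainD (r : ℕ) (σ τ : ℂ) (n : ℤ) : Set Point :=
  {X | (∑ i, X.1 i * (1 / 2) = n * τ + σ) ∧
       (∑ i, X.2 i * (1 / 2) = n + r - 1) ∧ X.2 ∈ latticeE8}

/-- `X + vT = (x + vτ, 𝐱 + v)`, the step being `T = (τ, 1)`. -/
def shiftT (τ : ℂ) (X : Point) (v : Fin 8 → ℚ) : Point :=
  (fun i => X.1 i + v i * τ, fun i => X.2 i + v i)

/-- The transformed variables `X̃ = (x̃, 𝐱̃)`. The sum runs over the block `{0,1,2,3}` or
`{4,5,6,7}` that contains `i`. -/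
def tilde (r : ℕ) (σ τ : ℂ) (X : Point) : Point :=
  (fun i => X.1 i + (σ + τ) / 2
      - 1 / 2 * ∑ j ∈ Finset.univ.filter (fun j : Fin 8 => j < 4 ↔ i < 4), X.1 j,
   fun i => X.2 i + r / 2
      - 1 / 2 * ∑ j ∈ Finset.univ.filter (fun j : Fin 8 => j < 4 ↔ i < 4), X.2 j)

/-! ### Contours -/

/-- A contour connecting `0` and `1`: a continuous curve on `[0,1]`, continuously differentiable
with bounded derivative off a finite set. -/
structure Contour where
  toFun : ℝ → ℂ
  continuousOn : ContinuousOn toFun (Set.Icc 0 1)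
  map_zero : toFun 0 = 0
  map_one : toFun 1 = 1
  piecewise : ∃ (F : Finset ℝ) (M : ℝ), ∀ t ∈ Set.Icc (0 : ℝ) 1, t ∉ F →
    ContDiffAt ℝ 1 toFun t ∧ ‖deriv toFun t‖ ≤ M

/-- The `1`-periodic extension of the contour, as a subset of the plane. -/
def Contour.trace (C : Contour) : Set ℂ :=
  {z | ∃ t ∈ Set.Icc (0 : ℝ) 1, ∃ k : ℤ, z = C.toFun t + k}

/-- `p` lies above the contour: it can be joined, without meeting the periodic contour, to a point
higher than the whole contour. -/
def Contour.Above (C : Contour) (p : ℂ) : Prop :=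
  ∃ q : ℂ, (∀ t ∈ Set.Icc (0 : ℝ) 1, (C.toFun t).im < q.im) ∧ JoinedIn C.traceᶜ p q

/-- `p` lies below the contour. -/
def Contour.Below (C : Contour) (p : ℂ) : Prop :=
  ∃ q : ℂ, (∀ t ∈ Set.Icc (0 : ℝ) 1, q.im < (C.toFun t).im) ∧ JoinedIn C.traceᶜ p q

/-- The undeformed contour `[0,1]`. -/
def Contour.segment : Contour where
  toFun t := t
  continuousOn := Complex.continuous_ofReal.continuousOn
  map_zero := by simp
  map_one := by simp
  piecewise := ⟨∅, 1, fun t _ _ =>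
    ⟨Complex.ofRealCLM.contDiff.contDiffAt, by
      rw [show deriv (fun t : ℝ => (t : ℂ)) t = 1 from (Complex.ofRealCLM.hasDerivAt).deriv]
      simp⟩⟩

/-! ### The elliptic hypergeometric sum/integral -/

/-- The shifted summation variable
`k + (r + ((r+1) mod 2)) (𝐱_1 mod 1)`. -/
def discVar (r : ℕ) (xs : Fin 8 → ℚ) (k : ℕ) : ℚ :=
  k + (r + ((r + 1) % 2 : ℕ)) * Int.fract (xs 1)

/-- The integrand
`Δ(z, s; x, 𝐱) = ∏_j Γ(x_j ± z, 𝐱_j ± s) / Γ(±2z, ±2s)`; here `s` is the already shifted discrete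
variable. -/
def integrand (r : ℕ) (σ τ : ℂ) (X : Point) (z : ℂ) (s : ℚ) : ℂ :=
  (∏ j, (lensGamma r σ τ (X.1 j + z) (X.2 j + s) * lensGamma r σ τ (X.1 j - z) (X.2 j - s))) /
    (lensGamma r σ τ (2 * z) (2 * s) * lensGamma r σ τ (-(2 * z)) (-(2 * s)))

/-- The contour separates the poles of the factors `Γ(x_j - z, ·)` of the integrand (above) from
those of the factors `Γ(x_j + z, ·)` (below). If `Im x_j > 0` for all `j`, then `[0,1]` does, and
this is the property that is kept when the contour is deformed without crossing poles. -/
def Admissible (r : ℕ) (σ τ : ℂ) (X : Point) (C : Contour) : Prop :=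
  ∀ k ∈ Finset.range r, ∀ (j : Fin 8) (z : ℂ),
    (IsGammaPole r σ τ (X.2 j + discVar r X.2 k) (X.1 j + z) → C.Below z) ∧
    (IsGammaPole r σ τ (X.2 j - discVar r X.2 k) (X.1 j - z) → C.Above z)

/-- `λ(σ, τ)`. -/
def lam (r : ℕ) (σ τ : ℂ) : ℂ :=
  qPoch (e (r * σ)) (e (r * σ)) * qPoch (e (r * τ)) (e (r * τ))

/-- The sum/integral `I(x, 𝐱; σ, τ)`, along the contour `C`. -/
def sumIntegral (r : ℕ) (σ τ : ℂ) (C : Contour) (X : Point) : ℂ :=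
  lam r σ τ / 2 * ∑ k ∈ Finset.range r,
    ∫ t in (0 : ℝ)..1,
      integrand r σ τ X (C.toFun t) (discVar r X.2 k) * deriv C.toFun t

/-- `ψ(X) = I(x̃, 𝐱̃; σ, τ)`. -/
def psi (r : ℕ) (σ τ : ℂ) (C : Contour) (X : Point) : ℂ :=
  sumIntegral r σ τ C (tilde r σ τ X)

/-! ### The hypergeometric `τ`-function -/

/-- The frame `a_0 = ½(v_0+v_1+v_2+v_3)`, `a_1 = ½(v_0+v_1-v_2-v_3)`,
`a_2 = ½(v_0-v_1+v_2-v_3)`. -/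
def frame : Fin 3 → Fin 8 → ℚ :=
  ![![1/2, 1/2, 1/2, 1/2, 0, 0, 0, 0],
    ![1/2, 1/2, -1/2, -1/2, 0, 0, 0, 0],
    ![1/2, -1/2, 1/2, -1/2, 0, 0, 0, 0]]

/-- `v_{ij}^{(n)} = (1-n) a_0 + (n+1-i-j) a_1 + (j-i) a_2`. -/
def frameShift (n i j : ℤ) : Fin 8 → ℚ :=
  (1 - n) • frame 0 + (n + 1 - i - j) • frame 1 + (j - i) • frame 2

/-- The matrix `(ψ_{ij}^{(n)}(X))_{i,j=1}^n`, `ψ_{ij}^{(n)}(X) = ψ(X + v_{ij}^{(n)} T)`. -/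
def psiMatrix (r : ℕ) (σ τ : ℂ) (C : Contour) (n : ℕ) (X : Point) : Matrix (Fin n) (Fin n) ℂ :=
  fun i j => psi r σ τ C (shiftT τ X (frameShift n ((i : ℕ) + 1) ((j : ℕ) + 1)))

/-- The function `𝒢^{(n)}(X)`. -/
def calG (r : ℕ) (σ τ μ : ℂ) (n : ℕ) (X : Point) : ℂ :=
  (∏ p ∈ Finset.univ.filter (fun p : Fin 8 × Fin 8 => p.1 < 4 ∧ 4 ≤ p.2),
    (tripleGamma r σ τ τ ((1 - n) * τ + X.1 p.1 + X.1 p.2) (1 - n + X.2 p.1 + X.2 p.2) *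
      gammaPlusTau r σ τ μ (X.1 p.1 + X.1 p.2) (X.2 p.1 + X.2 p.2) ^ n)) *
  ∏ p ∈ Finset.univ.filter (fun p : Fin 8 × Fin 8 => p.1 < p.2 ∧ (p.2 < 4 ∨ 4 ≤ p.1)),
    (tripleGamma r σ τ τ (τ + X.1 p.1 + X.1 p.2) (1 + X.2 p.1 + X.2 p.2) *
      gammaPlusTau r σ τ μ (X.1 p.1 + X.1 p.2 + μ) (X.2 p.1 + X.2 p.2) ^ n)

/-- The function `d^{(n)}(X)`. -/
def dFun (r : ℕ) (σ τ : ℂ) (n : ℕ) (X : Point) : ℂ :=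
  Complex.exp (4 * Real.pi * Complex.I / r * (τ - 1) * (n.choose 3 : ℂ)) *
  Complex.exp (2 * Real.pi * Complex.I / r *
    (σ + τ - X.1 0 - X.1 1 + X.2 0 + X.2 1) * (n.choose 2 : ℂ)) *
  ∏ k ∈ Finset.Icc 1 n,
    (lensThetaPoch r σ τ (X.1 0 + X.1 3 + (1 - n) * τ) (X.2 0 + X.2 3 + (1 - n)) (k - 1) *
     lensThetaPoch r σ τ (X.1 1 + X.1 2 + (1 - n) * τ) (X.2 1 + X.2 2 + (1 - n)) (k - 1) *
     lensThetaPoch r σ τ (X.1 0 - X.1 3 - (k - 1) * τ) (X.2 0 - X.2 3 - (k - 1)) (n - k) *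
     lensThetaPoch r σ τ (X.1 1 - X.1 2 - (k - 1) * τ) (X.2 1 - X.2 2 - (k - 1)) (n - k))

/-- `Q(X) = (2πi/r) ((x|x)/(2τ) - (𝐱|𝐱)/2)`. -/
def quadQ (r : ℕ) (τ : ℂ) (X : Point) : ℂ :=
  2 * Real.pi * Complex.I / r *
    (1 / (2 * τ) * ∑ i, X.1 i * X.1 i - 1 / 2 * ∑ i, (X.2 i : ℂ) * (X.2 i : ℂ))

/-- The function `e^{(n)}(X)`. -/
def eFun (r : ℕ) (σ τ : ℂ) (n : ℕ) (X : Point) : ℂ :=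
  Complex.exp (2 * Real.pi * Complex.I / r * (σ + 1) * (n.choose 2 : ℂ)) *
    Complex.exp (-(n * quadQ r τ X))

/-- `g^{(n)} = e^{(n)} 𝒢^{(n)} / d^{(n)}`. -/
def gFun (r : ℕ) (σ τ μ : ℂ) (n : ℕ) (X : Point) : ℂ :=
  eFun r σ τ n X / dFun r σ τ n X * calG r σ τ μ n X

/-- The hypergeometric `τ`-function in Casorati determinant form, `τ^{(n)}` on `D_n`. -/
def tauFun (r : ℕ) (σ τ μ : ℂ) (C : Contour) : ℤ → Point → ℂ
  | Int.ofNat n, X => gFun r σ τ μ n X * (psiMatrix r σ τ C n X).det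
  | Int.negSucc _, _ => 0

/-- The `n`-dimensional sum/integral `I_n(X)`, along the contour `C` in each variable. -/
def multiIntegral (r : ℕ) (σ τ : ℂ) (C : Contour) (n : ℕ) (X : Point) : ℂ :=
  lam r σ τ ^ n / (2 ^ n * (Nat.factorial n : ℂ)) *
  ∑ k : Fin n → Fin r,
    ∫ t in Set.univ.pi (fun _ : Fin n => Set.Icc (0 : ℝ) 1),
      (∏ p ∈ Finset.univ.filter (fun p : Fin n × Fin n => p.1 < p.2),
        ∏ ε : ℤˣ, ∏ δ : ℤˣ,
          lensTheta r σ τ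
            ((ε : ℤ) * C.toFun (t p.1) + (δ : ℤ) * C.toFun (t p.2))
            ((ε : ℤ) * discVar r (tilde r σ τ X).2 (k p.1)
              + (δ : ℤ) * discVar r (tilde r σ τ X).2 (k p.2))) *
      ∏ i, (integrand r σ τ (tilde r σ τ X) (C.toFun (t i))
              (discVar r (tilde r σ τ X).2 (k i)) * deriv C.toFun (t i))

/-- The contour `[0,1]` is admissible if all `x_j` lie in the upper half plane. -/
theorem admissible_segment (r : ℕ) (hr : 0 < r) (σ τ : ℂ) (hσ : 0 < σ.im) (hτ : 0 < τ.im)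
    (X : Point) (hX : ∀ j, 0 < (X.1 j).im) : Admissible r σ τ X Contour.segment := by
  have pole : ∀ (s : ℚ) (p : ℂ), IsGammaPole r σ τ s p → p.im ≤ 0 := by
    rintro s p ⟨j, k, l, h⟩
    have h0 : (0 : ℝ) ≤ ((⌊s⌋ % (r : ℤ) : ℤ) : ℝ) := by
      exact_mod_cast Int.emod_nonneg _ (by omega)
    have h1 : ((⌊s⌋ % (r : ℤ) : ℤ) : ℝ) ≤ r := by
      exact_mod_cast (Int.emod_lt_of_pos _ (by omega : (0 : ℤ) < r)).le
    generalize (⌊s⌋ % (r : ℤ) : ℤ) = m at h h0 h1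
    have hj : (0 : ℝ) ≤ j := Nat.cast_nonneg j
    have hk : (0 : ℝ) ≤ k := Nat.cast_nonneg k
    have hr' : (0 : ℝ) ≤ r := Nat.cast_nonneg r
    rcases h with h | h
    · have : p.im = -(σ.im * m + (σ.im + τ.im) * j + σ.im * r * k) := by
        rw [h]; simp
      rw [this]
      have : 0 ≤ σ.im * m + (σ.im + τ.im) * j + σ.im * r * k := by positivity
      linarith
    · have : p.im = -(τ.im * (r - m) + (σ.im + τ.im) * j + τ.im * r * k) := by
        rw [h]; simp
      rw [this]
      have hm : (0 : ℝ) ≤ r - m := by linarith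
      have : 0 ≤ τ.im * (r - m) + (σ.im + τ.im) * j + τ.im * r * k := by positivity
      linarith
  have tr : ∀ z : ℂ, z.im ≠ 0 → z ∈ Contour.segment.traceᶜ := by
    rintro z hz ⟨t, -, k, rfl⟩
    exact hz (by simp [Contour.segment])
  intro k _ j z
  refine ⟨fun h => ?_, fun h => ?_⟩
  · have h1 := pole _ _ h
    have h2 := hX j
    rw [Complex.add_im] at h1
    have hz : z.im < 0 := by linarith
    exact ⟨z, fun t _ => by simpa [Contour.segment] using hz, JoinedIn.refl (tr z hz.ne)⟩
  · have h1 := pole _ _ h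
    have h2 := hX j
    rw [Complex.sub_im] at h1
    have hz : 0 < z.im := by linarith
    exact ⟨z, fun t _ => by simpa [Contour.segment] using hz, JoinedIn.refl (tr z hz.ne')⟩

end LensTau

end

noncomputable section

namespace LensTau

/-! ### Infinite products `∏ (1 - w c_i)` -/

section LinearProducts

variable {ι : Type*} {c : ι → ℂ}

/-! The coordinates of v_ij^{(n)} in {0,1,2,3} have half sum 1 - n. Passing to X̃ therefore turns
the shift by v_ij^{(n)} T into shifts of the coordinates 0, 1, 2, 3 by n-i, n-j, j-1, i-1 steps T
(`tilde_shiftT`). These numbers are nonnegative, so the equation Γ(z+τ, s+1) = θ_σ(z, s) Γ(z, s)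
(`lensGamma_shift_tau`) only multiplies the integrand by finite theta products and creates no new
poles. Coordinates 0, 3 see only i and coordinates 1, 2 only j, so every matrix entry is a
sum/integral of F_i G_j Δ with one fixed Δ. Andréief's identity (`det_sum_integral`) turns the
determinant into 1/n! times the n-fold sum/integral of det F_i(z_l) · det G_j(z_l) · ∏ Δ(z_l).

Both inner determinants are elliptic Vandermonde determinants. By Jacobi's triple product, x⁻¹ θ(xy)
θ(x/y) is the 2×2 determinant [u, v] of two vectors in ℂ² (`thetaPair_eq_wedge`). Up to exponentials
the matrix entries become ∏ [α_m, z_l] ∏ [β_m, z_l], and such a determinant follows from the Plücker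
relation alone (`det_wedgeMatrix`). The product of the two values contains ∏ [z_i, z_j]², which is ∏
θ_σ(±z_i ± z_j) up to exponentials, and the constants [α_a, β_b] assemble to d^{(n)}(X)
(`pair_identity`).

On the analytic side, division by zero can give the integrand wrong values on a countable set of z.
A regularised integrand is continuous along an admissible contour, and the countable set does not
matter for integration against C'(t) dt (`ae_mul_deriv_eq`). -/

theorem multipliable_one_sub_mul (hc : Summable fun i => ‖c i‖) (w : ℂ) :
    Multipliable fun i => 1 - w * c i := by
  have h : Summable fun i => ‖-(w * c i)‖ := by
    simpa only [norm_neg, norm_mul] using hc.mul_left ‖w‖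
  simpa only [sub_eq_add_neg] using multipliable_one_add_of_summable h

theorem tprod_one_sub_mul_ne_zero (hc : Summable fun i => ‖c i‖) {w : ℂ}
    (hw : ∀ i, w * c i ≠ 1) : ∏' i, (1 - w * c i) ≠ 0 := by
  have h : Summable fun i => ‖-(w * c i)‖ := by
    simpa only [norm_neg, norm_mul] using hc.mul_left ‖w‖
  simp only [sub_eq_add_neg]
  refine tprod_one_add_ne_zero_of_summable (fun i hi => hw i ?_) h
  linear_combination -hi

theorem continuous_tprod_one_sub_mul (hc : Summable fun i => ‖c i‖) :
    Continuous fun w : ℂ => ∏' i, (1 - w * c i) := by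
  refine continuous_iff_continuousAt.2 fun w => ?_
  simp only [sub_eq_add_neg]
  -- The bound (‖w‖ + 1)‖c_i‖ serves all points of the unit ball around w.
  refine tendsto_tprod_one_add_of_dominated_convergence
    (bound := fun i => (‖w‖ + 1) * ‖c i‖) (hc.mul_left _)
    (fun i => (Continuous.tendsto (by fun_prop) w)) ?_
  have : ∀ᶠ v in nhds w, ‖v‖ < ‖w‖ + 1 :=
    (continuous_norm.tendsto w).eventually (gt_mem_nhds (by linarith))
  filter_upwards [this] with v hv i
  rw [norm_neg, norm_mul]
  gcongr

end LinearProducts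

/-! ### The `q`-shifted factorial -/

theorem summable_norm_pow {q : ℂ} (hq : ‖q‖ < 1) : Summable fun j : ℕ => ‖q ^ j‖ := by
  simpa only [norm_pow] using summable_geometric_of_lt_one (norm_nonneg q) hq

theorem qPoch_ne_zero {z q : ℂ} (hq : ‖q‖ < 1) (hz : ∀ j : ℕ, z * q ^ j ≠ 1) : qPoch z q ≠ 0 :=
  tprod_one_sub_mul_ne_zero (summable_norm_pow hq) hz

theorem continuous_qPoch {q : ℂ} (hq : ‖q‖ < 1) : Continuous fun z => qPoch z q :=
  continuous_tprod_one_sub_mul (summable_norm_pow hq)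

theorem qPoch_eq_mul {q : ℂ} (hq : ‖q‖ < 1) (z : ℂ) : qPoch z q = (1 - z) * qPoch (z * q) q := by
  have h : HasProd (fun j : ℕ => 1 - z * q * q ^ j) (qPoch (z * q) q) :=
    (multipliable_one_sub_mul (summable_norm_pow hq) (z * q)).hasProd
  have h' : HasProd (fun j : ℕ => 1 - z * q ^ (j + 1)) (qPoch (z * q) q) := by
    simpa only [pow_succ', mul_assoc] using h
  have h2 := HasProd.zero_mul (f := fun j : ℕ => 1 - z * q ^ j) h'
  rw [pow_zero, mul_one] at h2
  exact h2.tprod_eq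

/-- Peeling the first factor from (z; q)_∞ and from (1/z; q)_∞ leaves 1 - 1/z = -(1 - z)/z, without
dividing by a product that could vanish. -/
theorem theta_mul_base {q z : ℂ} (hq : ‖q‖ < 1) (hq0 : q ≠ 0) (hz : z ≠ 0) :
    theta (z * q) q = -z⁻¹ * theta z q := by
  have h1 := qPoch_eq_mul hq z
  have h2 := qPoch_eq_mul hq z⁻¹
  have e1 : q * (z * q)⁻¹ = z⁻¹ := by field_simp
  rw [theta, theta, e1, h1, h2, mul_comm z⁻¹ q]
  field_simp
  ring

theorem theta_base_div {q z : ℂ} (hq0 : q ≠ 0) (hz : z ≠ 0) :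
    theta (q * z⁻¹) q = theta z q := by
  have e1 : q * (q * z⁻¹)⁻¹ = z := by field_simp
  rw [theta, theta, e1, mul_comm]

theorem continuousOn_theta {q : ℂ} (hq : ‖q‖ < 1) :
    ContinuousOn (fun z => theta z q) {z | z ≠ 0} := by
  refine (continuous_qPoch hq).continuousOn.mul
    ((continuous_qPoch hq).comp_continuousOn ?_)
  exact continuousOn_const.mul (continuousOn_inv₀)

/-! ### The double product -/

/-- The double product `∏_{j,k ≥ 0} (1 - w Q^j P^k)`. -/
def doublePoch (w Q P : ℂ) : ℂ := ∏' p : ℕ × ℕ, (1 - w * (Q ^ p.1 * P ^ p.2))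

theorem summable_norm_pow_mul_pow {Q P : ℂ} (hQ : ‖Q‖ < 1) (hP : ‖P‖ < 1) :
    Summable fun p : ℕ × ℕ => ‖Q ^ p.1 * P ^ p.2‖ := by
  simp only [norm_mul]
  exact (summable_norm_pow hQ).mul_of_nonneg (summable_norm_pow hP)
    (fun _ => norm_nonneg _) (fun _ => norm_nonneg _)

theorem doublePoch_ne_zero {w Q P : ℂ} (hQ : ‖Q‖ < 1) (hP : ‖P‖ < 1)
    (h : ∀ j k : ℕ, w * (Q ^ j * P ^ k) ≠ 1) : doublePoch w Q P ≠ 0 :=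
  tprod_one_sub_mul_ne_zero (summable_norm_pow_mul_pow hQ hP) fun p => h p.1 p.2

theorem continuous_doublePoch {Q P : ℂ} (hQ : ‖Q‖ < 1) (hP : ‖P‖ < 1) :
    Continuous fun w => doublePoch w Q P :=
  continuous_tprod_one_sub_mul (summable_norm_pow_mul_pow hQ hP)

theorem doublePoch_swap (w Q P : ℂ) : doublePoch w Q P = doublePoch w P Q := by
  rw [doublePoch, ← (Equiv.prodComm ℕ ℕ).tprod_eq, doublePoch]
  simp only [Equiv.prodComm_apply, Prod.fst_swap, Prod.snd_swap, mul_comm]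

/-- Fubini for an unconditionally convergent product. It reduces a shift by Q to peeling off one
`qPoch`. -/
theorem hasProd_qPoch_doublePoch {w Q P : ℂ} (hQ : ‖Q‖ < 1) (hP : ‖P‖ < 1) :
    HasProd (fun j : ℕ => qPoch (w * Q ^ j) P) (doublePoch w Q P) := by
  refine (multipliable_one_sub_mul (summable_norm_pow_mul_pow hQ hP) w).hasProd.prod_fiberwise
    fun j => ?_
  have h : HasProd (fun k : ℕ => 1 - w * Q ^ j * P ^ k) (qPoch (w * Q ^ j) P) :=
    (multipliable_one_sub_mul (summable_norm_pow hP) (w * Q ^ j)).hasProd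
  simpa only [mul_assoc] using h

theorem doublePoch_eq_mul_left {Q P : ℂ} (hQ : ‖Q‖ < 1) (hP : ‖P‖ < 1) (w : ℂ) :
    doublePoch w Q P = qPoch w P * doublePoch (w * Q) Q P := by
  have h := hasProd_qPoch_doublePoch (w := w * Q) hQ hP
  have h' : HasProd (fun j : ℕ => qPoch (w * Q ^ (j + 1)) P) (doublePoch (w * Q) Q P) := by
    simpa only [pow_succ', mul_assoc] using h
  have h2 := HasProd.zero_mul (f := fun j : ℕ => qPoch (w * Q ^ j) P) h'
  rw [pow_zero, mul_one] at h2
  exact (hasProd_qPoch_doublePoch hQ hP).unique h2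

/-- A quotient of products is the product of the quotients, with division by zero giving zero. -/
theorem tprod_div_doublePoch {v w Q P : ℂ} (hQ : ‖Q‖ < 1) (hP : ‖P‖ < 1) :
    ∏' p : ℕ × ℕ, (1 - v * (Q ^ p.1 * P ^ p.2)) / (1 - w * (Q ^ p.1 * P ^ p.2))
      = doublePoch v Q P / doublePoch w Q P := by
  have hs := summable_norm_pow_mul_pow hQ hP
  by_cases h : ∃ p : ℕ × ℕ, 1 - w * (Q ^ p.1 * P ^ p.2) = 0
  · have h1 : doublePoch w Q P = 0 := tprod_of_exists_eq_zero h
    rw [h1, div_zero]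
    obtain ⟨p, hp⟩ := h
    exact tprod_of_exists_eq_zero ⟨p, by rw [hp, div_zero]⟩
  · have h1 : doublePoch w Q P ≠ 0 := doublePoch_ne_zero hQ hP fun j k hjk =>
      h ⟨(j, k), by rw [hjk, sub_self]⟩
    exact ((multipliable_one_sub_mul hs v).hasProd.div₀
      (multipliable_one_sub_mul hs w).hasProd h1).tprod_eq

/-! ### The exponential `e` -/

theorem e_add (a b : ℂ) : e (a + b) = e a * e b := by
  rw [e, e, e, ← Complex.exp_add, mul_add]

theorem e_zero : e 0 = 1 := by simp [e]

theorem e_ne_zero (a : ℂ) : e a ≠ 0 := Complex.exp_ne_zero _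

theorem e_neg (a : ℂ) : e (-a) = (e a)⁻¹ := by
  rw [e, e, ← Complex.exp_neg, mul_neg]

theorem e_sub (a b : ℂ) : e (a - b) = e a * (e b)⁻¹ := by
  rw [sub_eq_add_neg, e_add, e_neg]

theorem e_nat_mul (a : ℂ) (n : ℕ) : e (n * a) = e a ^ n := by
  rw [e, e, ← Complex.exp_nat_mul]; congr 1; ring

theorem e_mul_nat (a : ℂ) (n : ℕ) : e (a * n) = e a ^ n := by
  rw [mul_comm, e_nat_mul]

theorem e_eq_one_iff {a : ℂ} : e a = 1 ↔ ∃ l : ℤ, a = l := by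
  have h0 : (2 * Real.pi * Complex.I : ℂ) ≠ 0 := Complex.two_pi_I_ne_zero
  rw [e, Complex.exp_eq_one_iff]
  refine exists_congr fun l => ⟨fun h => mul_left_cancel₀ h0 (by rw [h]; ring), fun h => ?_⟩
  rw [h]; ring

theorem e_int (l : ℤ) : e l = 1 := e_eq_one_iff.2 ⟨l, rfl⟩

theorem e_half : e (1 / 2) = -1 := by
  rw [e, show (2 * Real.pi * Complex.I * (1 / 2) : ℂ) = Real.pi * Complex.I by ring,
    Complex.exp_pi_mul_I]

theorem exp_eq_e {a : ℂ} (b : ℂ) (h : a = 2 * Real.pi * Complex.I * b) : Complex.exp a = e b := by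
  rw [e, h]

theorem e_eq_of_eq_add_int {a b : ℂ} (l : ℤ) (h : a = b + l) : e a = e b := by
  rw [h, e_add, e_int, mul_one]

theorem e_eq_neg_of_eq_add {a b : ℂ} (l : ℤ) (h : a = b + 1 / 2 + l) : e a = -e b := by
  rw [h, e_add, e_int, mul_one, e_add, e_half, mul_neg_one]

theorem norm_e_lt_one {a : ℂ} (ha : 0 < a.im) : ‖e a‖ < 1 := by
  rw [e, Complex.norm_exp, Real.exp_lt_one_iff]
  have : (2 * Real.pi * Complex.I * a).re = -(2 * Real.pi * a.im) := by simp
  rw [this]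
  have := mul_pos Real.two_pi_pos ha
  linarith

theorem continuous_e : Continuous e := by
  unfold e; fun_prop

/-! ### The triple product identity -/

section TripleProduct

variable {ω : ℂ}

/-- The summand `(-1)^m q^{m(m-1)/2} x^m` with `q = e(ω)`, `x = e(u)`. -/
def thetaTerm (ω u : ℂ) (m : ℤ) : ℂ := e (ω * (m * (m - 1) / 2) + m * (u + 1 / 2))

theorem thetaTerm_eq (ω u : ℂ) (m : ℤ) :
    thetaTerm ω u m = jacobiTheta₂_term m (u + 1 / 2 - ω / 2) ω := by
  rw [thetaTerm, jacobiTheta₂_term, e]; congr 1; ring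

theorem summable_thetaTerm (hω : 0 < ω.im) (u : ℂ) : Summable (thetaTerm ω u) := by
  rw [show thetaTerm ω u = fun m => jacobiTheta₂_term m (u + 1 / 2 - ω / 2) ω from
    funext (thetaTerm_eq ω u)]
  exact (summable_jacobiTheta₂_term_iff _ _).2 hω

theorem thetaTerm_succ (ω u : ℂ) (m : ℤ) :
    thetaTerm ω u (m + 1) = -(e u * e (ω * m)) * thetaTerm ω u m := by
  rw [← e_add, neg_eq_neg_one_mul, ← e_half, ← e_add, thetaTerm, thetaTerm, ← e_add]
  congr 1; push_cast; ring

/-- `1 / (q; q)_k`, extended by zero to negative `k`. -/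
def recipPoch (q : ℂ) (k : ℤ) : ℂ :=
  if k < 0 then 0 else (∏ j ∈ Finset.range k.toNat, (1 - q * q ^ j))⁻¹

theorem one_sub_mul_pow_ne_zero {q : ℂ} (hq : ‖q‖ < 1) (j : ℕ) : 1 - q * q ^ j ≠ 0 := by
  intro h
  have h1 : q ^ (j + 1) = 1 := by rw [pow_succ']; linear_combination -h
  have h2 : ‖q‖ ^ (j + 1) = 1 := by rw [← norm_pow, h1, norm_one]
  have h3 := pow_lt_one₀ (norm_nonneg q) hq (Nat.succ_ne_zero j)
  exact absurd h2 h3.ne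

theorem qPoch_self_ne_zero {q : ℂ} (hq : ‖q‖ < 1) : qPoch q q ≠ 0 :=
  qPoch_ne_zero hq fun j h => one_sub_mul_pow_ne_zero hq j (by rw [h, sub_self])

/-- The extension by zero respects the recursion because 1 - q^(k+1) vanishes at k = -1. Series can
therefore run over all of ℤ. -/
theorem recipPoch_eq {q : ℂ} (hq : ‖q‖ < 1) (k : ℤ) :
    recipPoch q k = (1 - q ^ (k + 1)) * recipPoch q (k + 1) := by
  rcases lt_trichotomy k (-1) with h | h | h
  · rw [recipPoch, recipPoch, if_pos (by omega), if_pos (by omega), mul_zero]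
  · subst h; simp [recipPoch]
  · lift k to ℕ using by omega
    have h1 : ¬ ((k : ℤ) < 0) := by omega
    have h2 : ¬ ((k : ℤ) + 1 < 0) := by omega
    have h3 : ((k : ℤ) + 1).toNat = k + 1 := by omega
    rw [recipPoch, recipPoch, if_neg h1, if_neg h2, h3, Int.toNat_natCast,
      Finset.prod_range_succ, mul_inv]
    have h4 := one_sub_mul_pow_ne_zero hq k
    have h5 : q ^ ((k : ℤ) + 1) = q * q ^ k := by
      rw [← pow_succ']; exact_mod_cast zpow_natCast q (k + 1)
    rw [h5]
    field_simp

theorem recipPoch_natCast (q : ℂ) (n : ℕ) :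
    recipPoch q n = (∏ j ∈ Finset.range n, (1 - q * q ^ j))⁻¹ := by
  rw [recipPoch, if_neg (by omega), Int.toNat_natCast]

theorem tendsto_recipPoch {q : ℂ} (hq : ‖q‖ < 1) :
    Filter.Tendsto (fun n : ℕ => recipPoch q n) Filter.atTop (nhds (qPoch q q)⁻¹) := by
  have h := (multipliable_one_sub_mul (summable_norm_pow hq) q).tendsto_prod_tprod_nat
  simp only [recipPoch_natCast]
  exact h.inv₀ (qPoch_self_ne_zero hq)

/-- A convergent sequence is bounded. The bound gives the dominating series for the limits of
`partialTheta`. -/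
theorem exists_norm_recipPoch_le {q : ℂ} (hq : ‖q‖ < 1) :
    ∃ K : ℝ, ∀ k : ℤ, ‖recipPoch q k‖ ≤ K := by
  obtain ⟨K, hK⟩ := (Metric.isBounded_range_of_tendsto _ (tendsto_recipPoch hq)).exists_norm_le
  refine ⟨K, fun k => ?_⟩
  by_cases h : k < 0
  · rw [recipPoch, if_pos h, norm_zero]
    exact (norm_nonneg _).trans (hK _ ⟨0, rfl⟩)
  · lift k to ℕ using by omega
    exact hK _ ⟨k, rfl⟩

/-- The partially completed theta series `∑_m (-1)^m q^{m(m-1)/2} x^m / (q; q)_{m+n}`. -/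
def partialTheta (ω u : ℂ) (n : ℤ) : ℂ := ∑' m : ℤ, thetaTerm ω u m * recipPoch (e ω) (m + n)

theorem summable_partialTheta (hω : 0 < ω.im) (u : ℂ) (n : ℤ) :
    Summable fun m : ℤ => thetaTerm ω u m * recipPoch (e ω) (m + n) := by
  obtain ⟨K, hK⟩ := exists_norm_recipPoch_le (norm_e_lt_one hω)
  refine Summable.of_norm_bounded ((summable_thetaTerm hω u).norm.mul_right K) fun m => ?_
  rw [norm_mul]
  exact mul_le_mul_of_nonneg_left (hK _) (norm_nonneg _)

theorem e_mul_int (a : ℂ) (m : ℤ) : e (a * m) = e a ^ m := by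
  rw [e, e, ← Complex.exp_int_mul]; congr 1; ring

/-- With 1/(q;q)_k = (1 - q^(k+1))/(q;q)_(k+1) at k = m + n, the part containing q^(m+n+1) is a
shifted copy of the series, by `thetaTerm_succ`. Iteration builds up the factors of (q/x; q)_∞. -/
theorem partialTheta_succ (hω : 0 < ω.im) (u : ℂ) (n : ℤ) :
    partialTheta ω u (n + 1) = (1 - e (ω * (n + 1) - u)) * partialTheta ω u n := by
  have hq := norm_e_lt_one hω
  have h1 := (summable_partialTheta hω u n).hasSum
  have h2 : HasSum (fun m : ℤ => -e (ω * (n + 1) - u) *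
      (thetaTerm ω u (m + 1) * recipPoch (e ω) (m + 1 + n)))
      (-e (ω * (n + 1) - u) * partialTheta ω u n) :=
    ((Equiv.addRight (1 : ℤ)).hasSum_iff.2 h1).mul_left _
  have h3 := h1.add h2
  rw [sub_mul, one_mul, sub_eq_add_neg, ← neg_mul]
  refine Eq.trans (tsum_congr fun m => ?_) h3.tsum_eq
  rw [recipPoch_eq hq (m + n), thetaTerm_succ, show m + 1 + n = m + n + 1 by ring,
    ← add_assoc, ← e_mul_int]
  have : e (ω * ((m + n + 1 : ℤ) : ℂ)) = e (ω * (n + 1) - u) * (e u * e (ω * m)) := by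
    rw [← e_add, ← e_add]; congr 1; push_cast; ring
  rw [this]
  ring

theorem thetaTerm_add_nat_mul (ω u : ℂ) (n : ℕ) (m : ℤ) :
    thetaTerm ω (u + n * ω) m = thetaTerm ω u m * (e ω ^ m) ^ n := by
  rw [← e_mul_int, ← e_nat_mul, thetaTerm, thetaTerm, ← e_add]
  congr 1; ring

/-- At n = 0 the terms with negative m drop out, and what remains is Euler's series for (x; q)_∞.
This equation in x, iterated, identifies it. -/
theorem partialTheta_zero_eq (hω : 0 < ω.im) (u : ℂ) :
    partialTheta ω u 0 = (1 - e u) * partialTheta ω (u + ω) 0 := by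
  have hq := norm_e_lt_one hω
  have h1 := (summable_partialTheta hω (u + ω) 0).hasSum
  have h2 : HasSum (fun m : ℤ => -e u *
      (thetaTerm ω (u + ω) (m - 1) * recipPoch (e ω) (m - 1 + 0)))
      (-e u * partialTheta ω (u + ω) 0) :=
    ((Equiv.subRight (1 : ℤ)).hasSum_iff.2 h1).mul_left _
  have h3 := h1.add h2
  rw [sub_mul, one_mul, sub_eq_add_neg, ← neg_mul]
  refine Eq.trans (tsum_congr fun m => ?_) h3.tsum_eq
  have ht := thetaTerm_succ ω u (m - 1)
  have hr := recipPoch_eq hq (m - 1)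
  have hs := thetaTerm_add_nat_mul ω u 1
  simp only [Nat.cast_one, one_mul, pow_one] at hs
  rw [sub_add_cancel] at ht hr
  rw [hs, hs, add_zero, add_zero, hr, ht]
  push_cast
  rw [← e_mul_int ω (m - 1)]
  push_cast
  ring

theorem partialTheta_zero_eq_prod (hω : 0 < ω.im) (u : ℂ) (n : ℕ) :
    partialTheta ω u 0 =
      (∏ j ∈ Finset.range n, (1 - e u * e ω ^ j)) * partialTheta ω (u + n * ω) 0 := by
  induction n with
  | zero => simp
  | succ n ih =>
    rw [ih, partialTheta_zero_eq hω (u + n * ω), Finset.prod_range_succ, e_add, e_nat_mul,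
      mul_assoc, add_assoc]
    congr 4
    push_cast
    ring

/-- Adding nω to u multiplies the m-th term by q^(mn): positive m die out, negative m are absent,
and m = 0 leaves 1. -/
theorem tendsto_partialTheta_add (hω : 0 < ω.im) (u : ℂ) :
    Filter.Tendsto (fun n : ℕ => partialTheta ω (u + n * ω) 0) Filter.atTop (nhds 1) := by
  have hq := norm_e_lt_one hω
  obtain ⟨K, hK⟩ := exists_norm_recipPoch_le hq
  have h1 : (1 : ℂ) = ∑' m : ℤ, if m = 0 then 1 else 0 := by rw [tsum_ite_eq]
  rw [h1]
  refine tendsto_tsum_of_dominated_convergence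
    ((summable_thetaTerm hω u).norm.mul_right K) (fun m => ?_)
    (Filter.Eventually.of_forall fun n m => ?_)
  · simp only [thetaTerm_add_nat_mul, add_zero]
    rcases lt_trichotomy m 0 with h | h | h
    · simp [recipPoch, h, h.ne]
    · subst h; simp [recipPoch, thetaTerm, e_zero]
    · rw [if_neg h.ne']
      lift m to ℕ using h.le
      have : ‖e ω ^ (m : ℤ)‖ < 1 := by
        rw [zpow_natCast, norm_pow]
        exact pow_lt_one₀ (norm_nonneg _) hq (by omega)
      simpa using ((tendsto_pow_atTop_nhds_zero_of_norm_lt_one this).const_mul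
        (thetaTerm ω u m)).mul_const (recipPoch (e ω) m)
  · rw [thetaTerm_add_nat_mul, add_zero]
    by_cases h : m < 0
    · rw [recipPoch, if_pos h, mul_zero, norm_zero]
      exact mul_nonneg (norm_nonneg _) ((norm_nonneg _).trans (hK 0))
    · lift m to ℕ using by omega
      have : ‖(e ω ^ (m : ℤ)) ^ n‖ ≤ 1 := by
        rw [zpow_natCast, norm_pow, norm_pow]
        exact pow_le_one₀ (by positivity) (pow_le_one₀ (norm_nonneg _) hq.le)
      rw [norm_mul, norm_mul]
      exact mul_le_mul (mul_le_of_le_one_right (norm_nonneg _) this) (hK _) (norm_nonneg _)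
        (norm_nonneg _)

theorem partialTheta_zero (hω : 0 < ω.im) (u : ℂ) : partialTheta ω u 0 = qPoch (e u) (e ω) := by
  have h1 := (multipliable_one_sub_mul
    (summable_norm_pow (norm_e_lt_one hω)) (e u)).tendsto_prod_tprod_nat
  have h2 := h1.mul (tendsto_partialTheta_add hω u)
  simp only [← partialTheta_zero_eq_prod hω u, mul_one] at h2
  exact tendsto_nhds_unique tendsto_const_nhds h2

theorem partialTheta_natCast (hω : 0 < ω.im) (u : ℂ) (n : ℕ) :
    partialTheta ω u n =
      qPoch (e u) (e ω) * ∏ j ∈ Finset.range n, (1 - e ω * (e u)⁻¹ * e ω ^ j) := by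
  induction n with
  | zero => simpa using partialTheta_zero hω u
  | succ n ih =>
    rw [Nat.cast_succ, partialTheta_succ hω, ih, Finset.prod_range_succ, e_sub,
      show ω * (((n : ℤ) : ℂ) + 1) = n * ω + ω by push_cast; ring, e_add, e_nat_mul]
    ring

theorem tendsto_partialTheta (hω : 0 < ω.im) (u : ℂ) :
    Filter.Tendsto (fun n : ℕ => partialTheta ω u n) Filter.atTop
      (nhds ((∑' m : ℤ, thetaTerm ω u m) * (qPoch (e ω) (e ω))⁻¹)) := by
  have hq := norm_e_lt_one hω
  obtain ⟨K, hK⟩ := exists_norm_recipPoch_le hq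
  rw [← tsum_mul_right]
  refine tendsto_tsum_of_dominated_convergence
    ((summable_thetaTerm hω u).norm.mul_right K) (fun m => ?_)
    (Filter.Eventually.of_forall fun n m => ?_)
  · refine Filter.Tendsto.const_mul _ ?_
    have h1 : Filter.Tendsto (fun n : ℕ => (m + (n : ℤ)).toNat) Filter.atTop Filter.atTop :=
      Filter.tendsto_atTop.2 fun b => by
        filter_upwards [Filter.eventually_ge_atTop (b + m.natAbs)] with n hn
        omega
    refine ((tendsto_recipPoch hq).comp h1).congr' ?_
    filter_upwards [Filter.eventually_ge_atTop m.natAbs] with n hn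
    simp only [Function.comp]
    rw [Int.toNat_of_nonneg (by omega)]
  · rw [norm_mul]
    exact mul_le_mul_of_nonneg_left (hK _) (norm_nonneg _)

/-- **Jacobi's triple product identity.** -/
theorem theta_mul_qPoch (hω : 0 < ω.im) (u : ℂ) :
    theta (e u) (e ω) * qPoch (e ω) (e ω) = ∑' m : ℤ, thetaTerm ω u m := by
  have hq := norm_e_lt_one hω
  have h1 := ((multipliable_one_sub_mul (summable_norm_pow hq)
    (e ω * (e u)⁻¹)).tendsto_prod_tprod_nat).const_mul (qPoch (e u) (e ω))
  simp only [← partialTheta_natCast hω] at h1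
  -- Two values of the limit n → ∞: the infinite product from the recursion in n, and the bilateral
  -- series divided by (q; q)_∞.
  have h2 := tendsto_nhds_unique h1 (tendsto_partialTheta hω u)
  have h3 : theta (e u) (e ω) = (∑' m : ℤ, thetaTerm ω u m) * (qPoch (e ω) (e ω))⁻¹ := h2
  rw [h3, inv_mul_cancel_right₀ (qPoch_self_ne_zero hq)]

end TripleProduct

/-! ### The addition formula -/

section Addition

variable {ω : ℂ}

/-- `∑_n q^{n²} x^{2n}`. -/
def evenTheta (ω u : ℂ) : ℂ := jacobiTheta₂ (2 * u) (2 * ω)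

/-- `∑_n q^{n²+n} x^{2n+1}`. -/
def oddTheta (ω u : ℂ) : ℂ := e u * jacobiTheta₂ (2 * u + ω) (2 * ω)

/-- `x⁻¹ θ(xy) θ(x/y)` with `x = e(u)`, `y = e(v)`. -/
def thetaPair (ω u v : ℂ) : ℂ := e (-u) * (theta (e (u + v)) (e ω) * theta (e (u - v)) (e ω))

theorem hasSum_evenTheta (hω : 0 < ω.im) (u : ℂ) :
    HasSum (fun n : ℤ => e (ω * n ^ 2 + 2 * n * u)) (evenTheta ω u) := by
  have h := hasSum_jacobiTheta₂_term (2 * u) (τ := 2 * ω) (by simpa using hω)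
  refine HasSum.congr_fun h fun n => ?_
  rw [jacobiTheta₂_term, e]; congr 1; ring

theorem hasSum_oddTheta (hω : 0 < ω.im) (u : ℂ) :
    HasSum (fun n : ℤ => e (ω * (n ^ 2 + n) + (2 * n + 1) * u)) (oddTheta ω u) := by
  have h := (hasSum_jacobiTheta₂_term (2 * u + ω) (τ := 2 * ω) (by simpa using hω)).mul_left (e u)
  refine HasSum.congr_fun h fun n => ?_
  rw [jacobiTheta₂_term, e, e, ← Complex.exp_add]; congr 1; ring

/-- Pairs of integers with even sum, followed by pairs with odd sum. -/
def parityEquiv : (ℤ × ℤ) ⊕ (ℤ × ℤ) ≃ ℤ × ℤ where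
  -- The shift by 1 in the even branch absorbs the prefactor x⁻¹ of `thetaPair`: the exponent m + n
  -- - 1 of x becomes 2 p.1 + 1.
  toFun := Sum.elim (fun p => (p.1 + 1 + p.2, p.1 + 1 - p.2)) fun p => (p.1 + p.2 + 1, p.1 - p.2)
  invFun p := if (p.1 + p.2) % 2 = 0 then Sum.inl ((p.1 + p.2) / 2 - 1, (p.1 - p.2) / 2)
    else Sum.inr ((p.1 + p.2) / 2, (p.1 - p.2) / 2)
  left_inv := by
    rintro (⟨a, b⟩ | ⟨a, b⟩)
    · have h : (a + 1 + b + (a + 1 - b)) % 2 = 0 := by omega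
      refine (if_pos h).trans ?_
      simp only [Sum.elim_inl, Sum.inl.injEq, Prod.mk.injEq]
      omega
    · have h : ¬ (a + b + 1 + (a - b)) % 2 = 0 := by omega
      refine (if_neg h).trans ?_
      simp only [Sum.elim_inr, Sum.inr.injEq, Prod.mk.injEq]
      omega
  right_inv := by
    rintro ⟨m, n⟩
    by_cases h : (m + n) % 2 = 0
    · simp only [if_pos h, Sum.elim_inl, Prod.mk.injEq]
      omega
    · simp only [if_neg h, Sum.elim_inr, Prod.mk.injEq]
      omega

theorem hasSum_mul_prod {ι κ : Type*} {f : ι → ℂ} {g : κ → ℂ} {a b : ℂ} (hf : HasSum f a)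
    (hg : HasSum g b) : HasSum (fun p : ι × κ => f p.1 * g p.2) (a * b) :=
  hf.mul hg (summable_mul_of_summable_norm hf.summable.norm hg.summable.norm)

/-- In the product of the triple product series for xy and x/y, the exponents m + n of x and m - n
of y have equal parity, and the quadratic exponent separates in the half sum and half difference.
Even m + n gives the first term, odd m + n the second with sign (-1)^(m+n). -/
theorem thetaPair_mul_qPoch (hω : 0 < ω.im) (u v : ℂ) :
    thetaPair ω u v * qPoch (e ω) (e ω) ^ 2
      = oddTheta ω u * evenTheta ω v - evenTheta ω u * oddTheta ω v := by
  have s1 := summable_thetaTerm hω (u + v)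
  have s2 := summable_thetaTerm hω (u - v)
  have h1 : HasSum (fun p : ℤ × ℤ => e (-u) * (thetaTerm ω (u + v) p.1 * thetaTerm ω (u - v) p.2))
      (thetaPair ω u v * qPoch (e ω) (e ω) ^ 2) := by
    have h : thetaPair ω u v * qPoch (e ω) (e ω) ^ 2 = e (-u) *
        ((∑' m, thetaTerm ω (u + v) m) * ∑' m, thetaTerm ω (u - v) m) := by
      rw [← theta_mul_qPoch hω, ← theta_mul_qPoch hω]
      unfold thetaPair
      ring
    rw [h]
    exact (hasSum_mul_prod s1.hasSum s2.hasSum).mul_left _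
  have hin := hasSum_mul_prod (hasSum_oddTheta hω u) (hasSum_evenTheta hω v)
  have hout := (hasSum_mul_prod (hasSum_evenTheta hω u) (hasSum_oddTheta hω v)).neg
  rw [sub_eq_add_neg]
  refine HasSum.unique (parityEquiv.hasSum_iff.2 h1) (HasSum.sum ?_ ?_)
  · refine HasSum.congr_fun hin fun p => ?_
    simp only [Function.comp, parityEquiv, Equiv.coe_fn_mk, Sum.elim_inl, thetaTerm]
    rw [← e_add, ← e_add, ← e_add]
    refine e_eq_of_eq_add_int (p.1 + 1) ?_
    push_cast
    ring
  · refine HasSum.congr_fun hout fun p => ?_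
    simp only [Function.comp, parityEquiv, Equiv.coe_fn_mk, Sum.elim_inr, thetaTerm]
    rw [← e_add, ← e_add, ← e_add]
    refine e_eq_neg_of_eq_add p.1 ?_
    push_cast
    ring

theorem evenTheta_neg (ω u : ℂ) : evenTheta ω (-u) = evenTheta ω u := by
  rw [evenTheta, mul_neg, jacobiTheta₂_neg_left, evenTheta]

/-- The names even and odd refer to the exponents of x. Both series are even functions of u, this
one by quasi-periodicity of `jacobiTheta₂`. -/
theorem oddTheta_neg (ω u : ℂ) : oddTheta ω (-u) = oddTheta ω u := by
  have h := jacobiTheta₂_add_left' (2 * u - ω) (2 * ω)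
  rw [show 2 * u - ω + 2 * ω = 2 * u + ω by ring] at h
  rw [oddTheta, oddTheta, h, show 2 * -u + ω = -(2 * u - ω) by ring, jacobiTheta₂_neg_left,
    ← mul_assoc, exp_eq_e (-(2 * u)) (by ring), ← e_add]
  congr 2
  ring

theorem thetaPair_neg_left (hω : 0 < ω.im) (u v : ℂ) : thetaPair ω (-u) v = thetaPair ω u v := by
  refine mul_right_cancel₀ (pow_ne_zero 2 (qPoch_self_ne_zero (norm_e_lt_one hω))) ?_
  rw [thetaPair_mul_qPoch hω, thetaPair_mul_qPoch hω, evenTheta_neg, oddTheta_neg]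

/-- The vector whose wedge products are the values of `thetaPair`. -/
def thetaVec (ω u : ℂ) : ℂ × ℂ :=
  ((qPoch (e ω) (e ω))⁻¹ * oddTheta ω u, (qPoch (e ω) (e ω))⁻¹ * evenTheta ω u)

theorem thetaPair_eq_wedge (hω : 0 < ω.im) (u v : ℂ) : thetaPair ω u v
    = (thetaVec ω u).1 * (thetaVec ω v).2 - (thetaVec ω u).2 * (thetaVec ω v).1 := by
  have h := qPoch_self_ne_zero (norm_e_lt_one hω)
  rw [eq_div_of_mul_eq (pow_ne_zero 2 h) (thetaPair_mul_qPoch hω u v), thetaVec, thetaVec]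
  field_simp

end Addition

/-! ### A determinant of products of wedges -/

section Wedge

/-- The `2 × 2` determinant of two vectors. -/
def wedge (a b : ℂ × ℂ) : ℂ := a.1 * b.2 - a.2 * b.1

/-- The Plücker relation in ℂ². For theta functions it becomes the three-term addition formula. -/
theorem wedge_mul_sub (a b u v : ℂ × ℂ) :
    wedge a u * wedge b v - wedge a v * wedge b u = wedge a b * wedge u v := by
  simp only [wedge]; ring

/-- The matrix `∏_{m < n-1-i} [α_m, z_l] ∏_{m < i} [β_m, z_l]`. -/
def wedgeMatrix (n : ℕ) (α β : ℕ → ℂ × ℂ) (z : Fin n → ℂ × ℂ) : Matrix (Fin n) (Fin n) ℂ :=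
  Matrix.of fun i l => (∏ m ∈ Finset.range (n - 1 - i), wedge (α m) (z l)) *
    ∏ m ∈ Finset.range i, wedge (β m) (z l)

/-- The bidiagonal matrix that clears the last column of `wedgeMatrix`. -/
def clearMatrix (n : ℕ) (α β : ℕ → ℂ × ℂ) (w : ℂ × ℂ) : Matrix (Fin (n + 1)) (Fin (n + 1)) ℂ :=
  Matrix.of fun i j => if j = i then (if i = Fin.last n then 1 else wedge (β i) w)
    else if (j : ℕ) = i + 1 then -wedge (α (n - 1 - i)) w else 0

theorem det_clearMatrix (n : ℕ) (α β : ℕ → ℂ × ℂ) (w : ℂ × ℂ) :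
    (clearMatrix n α β w).det = ∏ m ∈ Finset.range n, wedge (β m) w := by
  rw [Matrix.det_of_isUpperTriangular, Fin.prod_univ_castSucc]
  · have h : ∀ i : Fin n, i.castSucc ≠ Fin.last n := fun i => (Fin.castSucc_lt_last i).ne
    simp [clearMatrix, h, Finset.prod_range fun m => wedge (β m) w]
  · intro i j hij
    have hij : j < i := hij
    have h1 : j ≠ i := hij.ne
    have h2 : (j : ℕ) ≠ i + 1 := by have : (j : ℕ) < i := hij; omega
    simp [clearMatrix, h1, h2]

/-- Rows i and i + 1 of `wedgeMatrix` differ only by [α_{n-1-i}, z] against [β_i, z]. The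
combination taken by `clearMatrix` is a Plücker relation, so it carries the factor [z, w] and
vanishes at z = w. -/
theorem clearMatrix_mul_castSucc (n : ℕ) (α β : ℕ → ℂ × ℂ) (w : ℂ × ℂ)
    (z : Fin (n + 1) → ℂ × ℂ) (i : Fin n) (l : Fin (n + 1)) :
    (clearMatrix n α β w * wedgeMatrix (n + 1) α β z) i.castSucc l
      = (∏ m ∈ Finset.range (n - 1 - i), wedge (α m) (z l)) *
        (∏ m ∈ Finset.range i, wedge (β m) (z l)) *
        (wedge (α (n - 1 - i)) (β i) * wedge (z l) w) := by
  have hi := i.2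
  have h0 : i.castSucc ≠ Fin.last n := (Fin.castSucc_lt_last i).ne
  rw [Matrix.mul_apply, Fintype.sum_eq_add i.castSucc i.succ (Fin.castSucc_lt_succ).ne]
  · have h1 : n + 1 - 1 - (i : ℕ) = n - 1 - i + 1 := by omega
    have h2 : n + 1 - 1 - ((i : ℕ) + 1) = n - 1 - i := by omega
    have h3 : i.succ ≠ i.castSucc := (Fin.castSucc_lt_succ).ne'
    simp only [clearMatrix, wedgeMatrix, Matrix.of_apply, if_true, if_neg h0, if_neg h3,
      Fin.val_succ, Fin.val_castSucc, h1, h2, Finset.prod_range_succ]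
    rw [← wedge_mul_sub]
    ring
  · rintro j ⟨hj1, hj2⟩
    have : ¬ (j : ℕ) = i + 1 := fun h => hj2 (Fin.ext (by simpa using h))
    simp [clearMatrix, hj1, this]

theorem clearMatrix_mul_last (n : ℕ) (α β : ℕ → ℂ × ℂ) (w : ℂ × ℂ)
    (z : Fin (n + 1) → ℂ × ℂ) (l : Fin (n + 1)) :
    (clearMatrix n α β w * wedgeMatrix (n + 1) α β z) (Fin.last n) l
      = ∏ m ∈ Finset.range n, wedge (β m) (z l) := by
  rw [Matrix.mul_apply, Fintype.sum_eq_single (Fin.last n)]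
  · simp [clearMatrix, wedgeMatrix]
  · intro j hj
    have : ¬ (j : ℕ) = n + 1 := by have := j.2; omega
    simp [clearMatrix, hj, this]

theorem wedge_self (a : ℂ × ℂ) : wedge a a = 0 := by simp only [wedge]; ring

/-- With w the last vector, the last column is cleared except in the last row, and the remaining
minor is the matrix of size n with scaled rows and columns. The determinant of `clearMatrix` stays
on both sides because it may be zero. -/
theorem prod_mul_det_wedgeMatrix_succ (n : ℕ) (α β : ℕ → ℂ × ℂ) (z : Fin (n + 1) → ℂ × ℂ) :
    (∏ m ∈ Finset.range n, wedge (β m) (z (Fin.last n))) * (wedgeMatrix (n + 1) α β z).det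
      = (∏ m ∈ Finset.range n, wedge (β m) (z (Fin.last n))) *
        ((∏ i : Fin n, (wedge (α (n - 1 - i)) (β i))) *
          (∏ i : Fin n, wedge (z i.castSucc) (z (Fin.last n))) *
          (wedgeMatrix n α β fun i => z i.castSucc).det) := by
  rw [← det_clearMatrix n α β (z (Fin.last n)), ← Matrix.det_mul,
    Matrix.det_succ_column _ (Fin.last n), Fin.sum_univ_castSucc]
  simp only [clearMatrix_mul_castSucc, wedge_self, mul_zero, zero_mul, Finset.sum_const_zero,
    zero_add, clearMatrix_mul_last, det_clearMatrix]
  have hs : (-1 : ℂ) ^ ((Fin.last n : ℕ) + (Fin.last n : ℕ)) = 1 := by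
    rw [← two_mul, pow_mul]; simp
  have hm : (clearMatrix n α β (z (Fin.last n)) * wedgeMatrix (n + 1) α β z).submatrix
      (Fin.last n).succAbove (Fin.last n).succAbove
      = Matrix.of fun i l : Fin n => wedge (α (n - 1 - i)) (β i) *
        Matrix.of (fun i l : Fin n => wedge (z l.castSucc) (z (Fin.last n)) *
          wedgeMatrix n α β (fun i => z i.castSucc) i l) i l := by
    ext i l
    rw [Matrix.submatrix_apply, Fin.succAbove_last, clearMatrix_mul_castSucc]
    simp only [Matrix.of_apply, wedgeMatrix]
    ring
  rw [hs, hm, Matrix.det_mul_column, Matrix.det_mul_row]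
  ring

/-- `∏_{i<j} [z_i, z_j]`. -/
def wedgeVandermonde (n : ℕ) (z : Fin n → ℂ × ℂ) : ℂ :=
  ∏ p ∈ Finset.univ.filter (fun p : Fin n × Fin n => p.1 < p.2), wedge (z p.1) (z p.2)

theorem prod_filter_lt_succ {M : Type*} [CommMonoid M] (n : ℕ)
    (f : Fin (n + 1) → Fin (n + 1) → M) :
    ∏ p ∈ Finset.univ.filter (fun p : Fin (n + 1) × Fin (n + 1) => p.1 < p.2), f p.1 p.2
      = (∏ i : Fin n, f i.castSucc (Fin.last n)) *
        ∏ p ∈ Finset.univ.filter (fun p : Fin n × Fin n => p.1 < p.2),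
          f p.1.castSucc p.2.castSucc := by
  have h : ∀ i : Fin n, ¬ Fin.last n < i.castSucc := fun i => (Fin.castSucc_lt_last i).not_gt
  simp only [Finset.prod_filter, Fintype.prod_prod_type, Fin.prod_univ_castSucc,
    Fin.castSucc_lt_castSucc_iff, Fin.castSucc_lt_last, if_true, h, if_false, lt_irrefl,
    Finset.prod_const_one, mul_one, Finset.prod_mul_distrib]
  rw [mul_comm]

theorem wedgeVandermonde_succ (n : ℕ) (z : Fin (n + 1) → ℂ × ℂ) :
    wedgeVandermonde (n + 1) z = (∏ i : Fin n, wedge (z i.castSucc) (z (Fin.last n))) *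
      wedgeVandermonde n fun i => z i.castSucc :=
  prod_filter_lt_succ n fun i j => wedge (z i) (z j)

/-- Enlarging n by one adds the antidiagonal a + b = n - 1 to the triangle. -/
theorem prod_triangle_succ {M : Type*} [CommMonoid M] (n : ℕ) (f : ℕ → ℕ → M) :
    ∏ a ∈ Finset.range (n + 1), ∏ b ∈ Finset.range (n + 1 - 1 - a), f a b
      = (∏ i : Fin n, f (n - 1 - i) i) *
        ∏ a ∈ Finset.range n, ∏ b ∈ Finset.range (n - 1 - a), f a b := by
  rw [Finset.prod_range_succ, Nat.add_sub_cancel, Nat.sub_self, Finset.prod_range_zero, mul_one,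
    ← Finset.prod_range (fun i => f (n - 1 - i) i),
    ← Finset.prod_range_reflect (fun i => f (n - 1 - i) i), ← Finset.prod_mul_distrib]
  refine Finset.prod_congr rfl fun a ha => ?_
  have ha := Finset.mem_range.1 ha
  rw [show n - a = n - 1 - a + 1 by omega, Finset.prod_range_succ, mul_comm,
    show n - 1 - (n - 1 - a) = a by omega]

theorem continuous_wedge (a : ℂ × ℂ) : Continuous (wedge a) := by
  unfold wedge; fun_prop

/-- Induction on n. The factor ∏ [β_m, z_last] to be cancelled may vanish, so the last vector is
moved along a curve on which it is nonzero for a dense set of parameters. Continuity then gives the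
original point. -/
theorem det_wedgeMatrix (n : ℕ) (α β : ℕ → ℂ × ℂ) (z : Fin n → ℂ × ℂ) :
    (wedgeMatrix n α β z).det
      = (∏ a ∈ Finset.range n, ∏ b ∈ Finset.range (n - 1 - a), wedge (α a) (β b)) *
        wedgeVandermonde n z := by
  induction n with
  | zero => simp [wedgeVandermonde]
  | succ n ih =>
    rw [prod_triangle_succ, wedgeVandermonde_succ]
    -- A zero vector β_m kills the last row on the left and the antidiagonal factor [α_{n-1-m}, β_m]
    -- on the right.
    by_cases hβ : ∃ m < n, β m = 0
    · obtain ⟨m, hm, hβ⟩ := hβ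
      have h0 : ∀ a, wedge a (β m) = 0 := fun a => by simp [wedge, hβ]
      have h1 : ∀ a, wedge (β m) a = 0 := fun a => by simp [wedge, hβ]
      rw [Finset.prod_eq_zero (Finset.mem_univ (⟨m, hm⟩ : Fin n)) (h0 _), zero_mul, zero_mul]
      refine Matrix.det_eq_zero_of_row_eq_zero (Fin.last n) fun l => ?_
      simp only [wedgeMatrix, Matrix.of_apply, Fin.val_last]
      rw [Finset.prod_eq_zero (f := fun m => wedge (β m) (z l)) (Finset.mem_range.2 hm) (h1 _),
        mul_zero]
    · push Not at hβ
      -- Along this curve [β_m, w(x)] is a polynomial in x with coefficients β_m.1 at x² and -β_m.2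
      -- at x, hence not the zero polynomial when β_m ≠ 0, wherever the curve starts.
      let w : ℂ → ℂ × ℂ := fun x => z (Fin.last n) + (x, x ^ 2)
      let Z : ℂ → Fin (n + 1) → ℂ × ℂ := fun x => Fin.snoc (fun i : Fin n => z i.castSucc) (w x)
      have hw : Continuous w := by fun_prop
      have hZl : ∀ x, Z x (Fin.last n) = w x := fun x => by simp [Z]
      have hZc : ∀ x (i : Fin n), Z x i.castSucc = z i.castSucc := fun x i => by simp [Z]
      have hZ : ∀ l, Continuous fun x => Z x l := by
        intro l
        refine Fin.lastCases ?_ (fun i => ?_) l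
        · simpa only [hZl] using hw
        · simpa only [hZc] using continuous_const
      let p : Polynomial ℂ := ∏ m ∈ Finset.range n,
        (Polynomial.C (wedge (β m) (z (Fin.last n))) + Polynomial.C (β m).1 * Polynomial.X ^ 2
          - Polynomial.C (β m).2 * Polynomial.X)
      have hp : p ≠ 0 := by
        refine Finset.prod_ne_zero_iff.2 fun m hm h => hβ m (Finset.mem_range.1 hm) ?_
        have h1 := congrArg (fun f => Polynomial.coeff f 1) h
        have h2 := congrArg (fun f => Polynomial.coeff f 2) h
        simp [Polynomial.coeff_C] at h1 h2
        exact Prod.ext h2 h1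
      have hev : ∀ x, p.eval x = ∏ m ∈ Finset.range n, wedge (β m) (w x) := by
        intro x
        rw [Polynomial.eval_prod]
        refine Finset.prod_congr rfl fun m _ => ?_
        simp [w, wedge]
        ring
      have hdense : Dense {x | p.eval x ≠ 0} := by
        have : {x | p.eval x ≠ 0} = (p.rootSet ℂ)ᶜ := by
          ext x; simp [Polynomial.mem_rootSet, hp]
        rw [this]
        exact (Set.toFinite (p.rootSet ℂ)).countable.dense_compl ℂ
      let A : ℂ := (∏ i : Fin n, wedge (α (n - 1 - i)) (β i)) *
        ∏ a ∈ Finset.range n, ∏ b ∈ Finset.range (n - 1 - a), wedge (α a) (β b)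
      have key := Continuous.ext_on (f := fun x => (wedgeMatrix (n + 1) α β (Z x)).det)
        (g := fun x => A * ((∏ i : Fin n, wedge (Z x i.castSucc) (Z x (Fin.last n))) *
          wedgeVandermonde n fun i => Z x i.castSucc)) hdense ?_ ?_ ?_
      · have h := congrFun key 0
        have hZ0 : Z 0 = z := by
          ext1 l
          refine Fin.lastCases ?_ (fun i => ?_) l
          · simp [hZl, w]
          · simp [hZc]
        simpa only [hZ0] using h
      · refine Continuous.matrix_det (continuous_matrix fun i l => ?_)
        simp only [wedgeMatrix, Matrix.of_apply]
        refine Continuous.mul ?_ ?_ <;>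
        exact continuous_finsetProd _ fun m _ => (continuous_wedge _).comp (hZ l)
      · simp only [hZc, hZl]
        refine continuous_const.mul (Continuous.mul ?_ continuous_const)
        exact continuous_finsetProd _ fun m _ => (continuous_wedge _).comp hw
      · intro x hx
        have hx : p.eval x ≠ 0 := hx
        have h := prod_mul_det_wedgeMatrix_succ n α β (Z x)
        rw [ih] at h
        rw [hev, ← hZl] at hx
        have h := mul_left_cancel₀ hx h
        dsimp only
        rw [h]
        simp only [A]
        ring

end Wedge

/-! ### Andréief's identity -/

open MeasureTheory

/-- For fixed π the sum over ρ is a determinant with rows permuted by π. The two signs of π cancel,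
leaving n! equal terms. -/
theorem sum_perm_perm_prod {n : ℕ} (M : Matrix (Fin n) (Fin n) ℂ) :
    ∑ π : Equiv.Perm (Fin n), ∑ ρ : Equiv.Perm (Fin n),
      ((Equiv.Perm.sign π : ℤ) : ℂ) * ((Equiv.Perm.sign ρ : ℤ) : ℂ) * ∏ l, M (π l) (ρ l)
      = (Nat.factorial n : ℂ) * M.det := by
  have h : ∀ π : Equiv.Perm (Fin n), ∑ ρ : Equiv.Perm (Fin n),
      ((Equiv.Perm.sign π : ℤ) : ℂ) * ((Equiv.Perm.sign ρ : ℤ) : ℂ) * ∏ l, M (π l) (ρ l)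
      = M.det := by
    intro π
    have h1 := Matrix.det_permute π M
    have h2 : ((Equiv.Perm.sign π : ℤ) : ℂ) * ((Equiv.Perm.sign π : ℤ) : ℂ) = 1 := by
      rw [← Int.cast_mul, ← Units.val_mul, Int.units_mul_self]; simp
    have h3 : (M.submatrix π id).det = ∑ ρ : Equiv.Perm (Fin n),
        ((Equiv.Perm.sign ρ : ℤ) : ℂ) * ∏ l, M (π l) (ρ l) := by
      rw [← Matrix.det_transpose, Matrix.det_apply']
      rfl
    simp only [mul_assoc, ← Finset.mul_sum]
    rw [← h3, h1, ← mul_assoc, h2, one_mul]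
  simp [h, Fintype.card_perm]

/-- Andréief's identity for counting measure on κ times ν: expand both determinants, split the
integral over l by Fubini, and collect with `sum_perm_perm_prod`. -/
theorem det_sum_integral {n : ℕ} {κ Ω : Type*} [Fintype κ] [MeasurableSpace Ω]
    {ν : Measure Ω} [SigmaFinite ν] (F G : Fin n → κ → Ω → ℂ) (D : κ → Ω → ℂ)
    (hint : ∀ i j k, Integrable (fun t => F i k t * G j k t * D k t) ν) :
    (Matrix.of fun i j => ∑ k, ∫ t, F i k t * G j k t * D k t ∂ν).det
      = (Nat.factorial n : ℂ)⁻¹ * ∑ k : Fin n → κ, ∫ t : Fin n → Ω,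
        (Matrix.of fun i l => F i (k l) (t l)).det * (Matrix.of fun j l => G j (k l) (t l)).det *
          ∏ l, D (k l) (t l) ∂(Measure.pi fun _ => ν) := by
  have hfac : (Nat.factorial n : ℂ) ≠ 0 := by exact_mod_cast Nat.factorial_ne_zero n
  rw [eq_inv_mul_iff_mul_eq₀ hfac, ← sum_perm_perm_prod]
  have h1 : ∀ k : Fin n → κ, ∫ t : Fin n → Ω,
        (Matrix.of fun i l => F i (k l) (t l)).det * (Matrix.of fun j l => G j (k l) (t l)).det *
          ∏ l, D (k l) (t l) ∂(Measure.pi fun _ => ν)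
      = ∑ π : Equiv.Perm (Fin n), ∑ ρ : Equiv.Perm (Fin n),
        ((Equiv.Perm.sign π : ℤ) : ℂ) * ((Equiv.Perm.sign ρ : ℤ) : ℂ) *
          ∏ l, ∫ t, F (π l) (k l) t * G (ρ l) (k l) t * D (k l) t ∂ν := by
    intro k
    have hI : ∀ π ρ : Equiv.Perm (Fin n), Integrable (fun t : Fin n → Ω =>
        ((Equiv.Perm.sign π : ℤ) : ℂ) * ((Equiv.Perm.sign ρ : ℤ) : ℂ) *
          ∏ l, (F (π l) (k l) (t l) * G (ρ l) (k l) (t l) * D (k l) (t l)))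
        (Measure.pi fun _ => ν) := fun π ρ =>
      (Integrable.fintype_prod (fun l => hint (π l) (ρ l) (k l))).const_mul _
    have h2 : ∀ t : Fin n → Ω,
        (Matrix.of fun i l => F i (k l) (t l)).det * (Matrix.of fun j l => G j (k l) (t l)).det *
          ∏ l, D (k l) (t l)
        = ∑ π : Equiv.Perm (Fin n), ∑ ρ : Equiv.Perm (Fin n),
          ((Equiv.Perm.sign π : ℤ) : ℂ) * ((Equiv.Perm.sign ρ : ℤ) : ℂ) *
            ∏ l, (F (π l) (k l) (t l) * G (ρ l) (k l) (t l) * D (k l) (t l)) := by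
      intro t
      rw [Matrix.det_apply', Matrix.det_apply', Finset.sum_mul_sum, Finset.sum_mul]
      refine Finset.sum_congr rfl fun π _ => ?_
      rw [Finset.sum_mul]
      refine Finset.sum_congr rfl fun ρ _ => ?_
      simp only [Matrix.of_apply, Finset.prod_mul_distrib]
      ring
    simp only [h2]
    rw [integral_finsetSum _ fun π _ => integrable_finsetSum _ fun ρ _ => hI π ρ]
    refine Finset.sum_congr rfl fun π _ => ?_
    rw [integral_finsetSum _ fun ρ _ => hI π ρ]
    refine Finset.sum_congr rfl fun ρ _ => ?_
    rw [integral_const_mul]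
    congr 1
    exact integral_fintype_prod_eq_prod
      fun l t => F (π l) (k l) t * G (ρ l) (k l) t * D (k l) t
  simp only [h1]
  refine Eq.trans ?_ Finset.sum_comm
  refine Finset.sum_congr rfl fun π _ => ?_
  refine Eq.trans ?_ Finset.sum_comm
  refine Finset.sum_congr rfl fun ρ _ => ?_
  rw [← Finset.mul_sum]
  congr 1
  simp only [Matrix.of_apply]
  exact Fintype.prod_sum fun l k => ∫ t, F (π l) k t * G (ρ l) k t * D k t ∂ν

/-! ### The elliptic gamma function -/

section EllGamma

variable {Q P : ℂ}

/-- The elliptic gamma function in multiplicative notation. -/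
def ellGamma (w Q P : ℂ) : ℂ := doublePoch (Q * P * w⁻¹) Q P / doublePoch w Q P

theorem ellGamma_mul_left (hQ : ‖Q‖ < 1) (hP : ‖P‖ < 1) (hQ0 : Q ≠ 0) {w : ℂ} (hw : w ≠ 0)
    (h : qPoch w P ≠ 0) : ellGamma (w * Q) Q P = theta w P * ellGamma w Q P := by
  have e1 : Q * P * (w * Q)⁻¹ = P * w⁻¹ := by field_simp
  rw [ellGamma, ellGamma, e1, theta, doublePoch_eq_mul_left hQ hP (P * w⁻¹),
    doublePoch_eq_mul_left hQ hP w, show P * w⁻¹ * Q = Q * P * w⁻¹ by ring]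
  field_simp

theorem ellGamma_swap (w Q P : ℂ) : ellGamma w Q P = ellGamma w P Q := by
  rw [ellGamma, ellGamma, doublePoch_swap, doublePoch_swap w, mul_comm Q P]

theorem ellGamma_mul_right (hQ : ‖Q‖ < 1) (hP : ‖P‖ < 1) (hP0 : P ≠ 0) {w : ℂ} (hw : w ≠ 0)
    (h : qPoch w Q ≠ 0) : ellGamma (w * P) Q P = theta w Q * ellGamma w Q P := by
  rw [ellGamma_swap, ellGamma_mul_left hP hQ hP0 hw h, ellGamma_swap]

theorem ellGamma_reflect (hQ0 : Q ≠ 0) (hP0 : P ≠ 0) {w : ℂ} (hw : w ≠ 0) :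
    ellGamma (Q * P * w⁻¹) Q P = (ellGamma w Q P)⁻¹ := by
  have e1 : Q * P * (Q * P * w⁻¹)⁻¹ = w := by field_simp
  rw [ellGamma, ellGamma, e1, inv_div]

theorem ellGamma_ne_zero (hQ : ‖Q‖ < 1) (hP : ‖P‖ < 1) {w : ℂ}
    (h1 : ∀ j k : ℕ, w * (Q ^ j * P ^ k) ≠ 1)
    (h2 : ∀ j k : ℕ, Q * P * w⁻¹ * (Q ^ j * P ^ k) ≠ 1) : ellGamma w Q P ≠ 0 :=
  div_ne_zero (doublePoch_ne_zero hQ hP h2) (doublePoch_ne_zero hQ hP h1)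

theorem continuousAt_ellGamma (hQ : ‖Q‖ < 1) (hP : ‖P‖ < 1) {w : ℂ} (hw : w ≠ 0)
    (h : ∀ j k : ℕ, w * (Q ^ j * P ^ k) ≠ 1) : ContinuousAt (fun w => ellGamma w Q P) w := by
  refine ContinuousAt.div ?_ (continuous_doublePoch hQ hP).continuousAt
    (doublePoch_ne_zero hQ hP h)
  have h1 : ContinuousAt (fun w : ℂ => Q * P * w⁻¹) w :=
    continuousAt_const.mul (continuousAt_inv₀ hw)
  exact ContinuousAt.comp (f := fun w : ℂ => Q * P * w⁻¹) (g := fun w => doublePoch w Q P)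
    (continuous_doublePoch hQ hP).continuousAt h1

end EllGamma

/-! ### The lens elliptic gamma function -/

section LensGamma

variable {r : ℕ} {σ τ : ℂ}

theorem im_mul_nat_pos (hr : 0 < r) (hσ : 0 < σ.im) : 0 < (σ * r).im := by
  have : (0 : ℝ) < r := by exact_mod_cast hr
  simpa using mul_pos hσ this

theorem im_add_pos (hσ : 0 < σ.im) (hτ : 0 < τ.im) : 0 < (σ + τ).im := by
  simpa using add_pos hσ hτ

theorem gammaSigma_eq (hr : 0 < r) (hσ : 0 < σ.im) (hτ : 0 < τ.im) (z : ℂ) (s : ℚ) :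
    gammaSigma r σ τ z s = ellGamma (e z * e (σ * s)) (e (σ + τ)) (e (σ * r)) := by
  rw [ellGamma, ← tprod_div_doublePoch (norm_e_lt_one (im_add_pos hσ hτ))
    (norm_e_lt_one (im_mul_nat_pos hr hσ)), gammaSigma]
  refine tprod_congr fun p => ?_
  rw [e_mul_nat, e_mul_nat, mul_add, mul_add, e_add, e_add, e_mul_nat, e_mul_nat, mul_inv,
    ← e_neg, ← e_neg, mul_one, mul_one]
  congr 2 <;> ring

theorem gammaTau_eq (hr : 0 < r) (hσ : 0 < σ.im) (hτ : 0 < τ.im) (z : ℂ) (s : ℚ) :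
    gammaTau r σ τ z s = ellGamma (e z * e (τ * (r - s))) (e (σ + τ)) (e (τ * r)) := by
  rw [ellGamma, ← tprod_div_doublePoch (norm_e_lt_one (im_add_pos hσ hτ))
    (norm_e_lt_one (im_mul_nat_pos hr hτ)), gammaTau]
  refine tprod_congr fun p => ?_
  rw [e_mul_nat, e_mul_nat, mul_add, mul_add, e_add, e_add, e_mul_nat, e_mul_nat, mul_inv,
    ← e_neg, ← e_neg, mul_one, mul_one]
  congr 2 <;> ring

/-- The additive group `ℤ + ℤσ + ℤτ`, which contains all zeros and poles of `z ↦ Γ(z, s)`. -/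
def periodSet (σ τ : ℂ) : Set ℂ := {z | ∃ l a b : ℤ, z = l + a * σ + b * τ}

theorem countable_periodSet (σ τ : ℂ) : (periodSet σ τ).Countable := by
  have : periodSet σ τ ⊆ Set.range fun p : ℤ × ℤ × ℤ => (p.1 + p.2.1 * σ + p.2.2 * τ : ℂ) := by
    rintro z ⟨l, a, b, rfl⟩
    exact ⟨(l, a, b), rfl⟩
  exact (Set.countable_range _).mono this

theorem e_ne_one_of_notMem {z w : ℂ} (hz : z ∉ periodSet σ τ) (a b : ℤ)
    (hw : w = z + a * σ + b * τ) : e w ≠ 1 := by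
  intro h
  obtain ⟨l, hl⟩ := e_eq_one_iff.1 h
  refine hz ⟨l, -a, -b, ?_⟩
  push_cast
  linear_combination hl - hw

theorem notMem_periodSet_add {z w : ℂ} (hz : z ∉ periodSet σ τ) (a b : ℤ)
    (hw : w = z + a * σ + b * τ) : w ∉ periodSet σ τ := by
  rintro ⟨l, c, d, h⟩
  refine hz ⟨l, c - a, d - b, ?_⟩
  push_cast
  linear_combination h - hw

theorem notMem_periodSet_neg {z : ℂ} (hz : z ∉ periodSet σ τ) : -z ∉ periodSet σ τ := by
  rintro ⟨l, c, d, h⟩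
  refine hz ⟨-l, -c, -d, ?_⟩
  push_cast
  linear_combination -h

theorem lensGamma_eq (hr : 0 < r) (hσ : 0 < σ.im) (hτ : 0 < τ.im) (z : ℂ) (s : ℚ) :
    lensGamma r σ τ z s = Complex.exp (phiE r σ τ z s) *
      ellGamma (e (z + σ * s)) (e (σ + τ)) (e (σ * r)) *
      ellGamma (e (z + τ * (r - s))) (e (σ + τ)) (e (τ * r)) := by
  rw [lensGamma, gammaSigma_eq hr hσ hτ, gammaTau_eq hr hσ hτ, ← e_add, ← e_add]

theorem ellGamma_sigma_ne_zero (hr : 0 < r) (hσ : 0 < σ.im) (hτ : 0 < τ.im) {z : ℂ}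
    (hz : z ∉ periodSet σ τ) (m : ℤ) :
    ellGamma (e (z + σ * m)) (e (σ + τ)) (e (σ * r)) ≠ 0 := by
  refine ellGamma_ne_zero (norm_e_lt_one (im_add_pos hσ hτ)) (norm_e_lt_one (im_mul_nat_pos hr hσ))
    (fun j k => ?_) (fun j k => ?_)
  · rw [← e_mul_nat, ← e_mul_nat, ← e_add, ← e_add]
    exact e_ne_one_of_notMem hz (m + j + r * k) j (by push_cast; ring)
  · rw [← e_mul_nat, ← e_mul_nat, ← e_neg, ← e_add, ← e_add, ← e_add, ← e_add]
    exact e_ne_one_of_notMem (notMem_periodSet_neg hz) (-m + 1 + r + j + r * k) (1 + j)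
      (by push_cast; ring)

theorem ellGamma_tau_ne_zero (hr : 0 < r) (hσ : 0 < σ.im) (hτ : 0 < τ.im) {z : ℂ}
    (hz : z ∉ periodSet σ τ) (m : ℤ) :
    ellGamma (e (z + τ * (r - m))) (e (σ + τ)) (e (τ * r)) ≠ 0 := by
  refine ellGamma_ne_zero (norm_e_lt_one (im_add_pos hσ hτ)) (norm_e_lt_one (im_mul_nat_pos hr hτ))
    (fun j k => ?_) (fun j k => ?_)
  · rw [← e_mul_nat, ← e_mul_nat, ← e_add, ← e_add]
    exact e_ne_one_of_notMem hz j (r - m + j + r * k) (by push_cast; ring)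
  · rw [← e_mul_nat, ← e_mul_nat, ← e_neg, ← e_add, ← e_add, ← e_add, ← e_add]
    exact e_ne_one_of_notMem (notMem_periodSet_neg hz) (1 + j) (1 + j + m + r * k)
      (by push_cast; ring)

theorem lensGamma_ne_zero (hr : 0 < r) (hσ : 0 < σ.im) (hτ : 0 < τ.im) {z : ℂ}
    (hz : z ∉ periodSet σ τ) (m : ℤ) : lensGamma r σ τ z m ≠ 0 := by
  rw [lensGamma_eq hr hσ hτ, Rat.cast_intCast]
  exact mul_ne_zero (mul_ne_zero (Complex.exp_ne_zero _) (ellGamma_sigma_ne_zero hr hσ hτ hz m))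
    (ellGamma_tau_ne_zero hr hσ hτ hz m)

theorem phiE_shift_tau (hr : 0 < r) (σ τ z : ℂ) (s : ℚ) :
    phiE r σ τ (z + τ) (s + 1) = phiSigma r σ τ z s + phiE r σ τ z s := by
  have : (r : ℂ) ≠ 0 := by exact_mod_cast hr.ne'
  rw [phiE, phiE, phiSigma]
  push_cast
  field_simp
  ring

/-- The step T multiplies e(z + σs) by e(σ + τ) and fixes z + τ(r - s), so only the first elliptic
gamma factor changes, by a theta function of base e(σr). The normalisations φ_e and φ_σ are matched
to this step. -/
theorem lensGamma_shift_tau (hr : 0 < r) (hσ : 0 < σ.im) (hτ : 0 < τ.im) {z : ℂ}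
    (hz : z ∉ periodSet σ τ) (m : ℤ) :
    lensGamma r σ τ (z + τ) (m + 1) = lensTheta r σ τ z m * lensGamma r σ τ z m := by
  have h1 : e (z + τ + σ * ((m + 1 : ℚ) : ℂ)) = e (z + σ * m) * e (σ + τ) := by
    rw [← e_add]; congr 1; push_cast; ring
  have h2 : e (z + τ + τ * (r - ((m + 1 : ℚ) : ℂ))) = e (z + τ * (r - m)) := by
    congr 1; push_cast; ring
  have h3 : qPoch (e (z + σ * m)) (e (σ * r)) ≠ 0 := by
    refine qPoch_ne_zero (norm_e_lt_one (im_mul_nat_pos hr hσ)) fun j => ?_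
    rw [← e_mul_nat, ← e_add]
    exact e_ne_one_of_notMem hz (m + r * j) 0 (by push_cast; ring)
  rw [lensGamma_eq hr hσ hτ, lensGamma_eq hr hσ hτ, h1, h2,
    ellGamma_mul_left (norm_e_lt_one (im_add_pos hσ hτ)) (norm_e_lt_one (im_mul_nat_pos hr hσ))
      (e_ne_zero _) (e_ne_zero _) h3, phiE_shift_tau hr, Complex.exp_add, lensTheta, ← e_add,
    Rat.cast_intCast]
  ring

/-- The step (σ, -1) fixes the first argument and multiplies the second by e(σ + τ). -/
theorem lensGamma_shift_sigma (hr : 0 < r) (hσ : 0 < σ.im) (hτ : 0 < τ.im) {z : ℂ}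
    (hz : z ∉ periodSet σ τ) (m : ℤ) :
    lensGamma r σ τ (z + σ) (m - 1) =
      Complex.exp (phiE r σ τ (z + σ) (m - 1) - phiE r σ τ z m) *
        theta (e (z + τ * (r - m))) (e (τ * r)) * lensGamma r σ τ z m := by
  have h1 : e (z + σ + σ * ((m - 1 : ℚ) : ℂ)) = e (z + σ * m) := by
    congr 1; push_cast; ring
  have h2 : e (z + σ + τ * (r - ((m - 1 : ℚ) : ℂ))) = e (z + τ * (r - m)) * e (σ + τ) := by
    rw [← e_add]; congr 1; push_cast; ring
  have h3 : qPoch (e (z + τ * (r - m))) (e (τ * r)) ≠ 0 := by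
    refine qPoch_ne_zero (norm_e_lt_one (im_mul_nat_pos hr hτ)) fun j => ?_
    rw [← e_mul_nat, ← e_add]
    exact e_ne_one_of_notMem hz 0 (r - m + r * j) (by push_cast; ring)
  rw [lensGamma_eq hr hσ hτ, lensGamma_eq hr hσ hτ, h1, h2,
    ellGamma_mul_left (norm_e_lt_one (im_add_pos hσ hτ)) (norm_e_lt_one (im_mul_nat_pos hr hτ))
      (e_ne_zero _) (e_ne_zero _) h3, Complex.exp_sub, Rat.cast_intCast]
  field_simp [Complex.exp_ne_zero]

theorem lensGamma_reflect (hr : 0 < r) (hσ : 0 < σ.im) (hτ : 0 < τ.im) (z : ℂ) (s : ℚ) :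
    lensGamma r σ τ (σ + τ - z) (r - s) = (lensGamma r σ τ z s)⁻¹ := by
  have h1 : e (σ + τ - z + σ * ((r - s : ℚ) : ℂ))
      = e (σ + τ) * e (σ * r) * (e (z + σ * s))⁻¹ := by
    rw [← e_neg, ← e_add, ← e_add]; congr 1; push_cast; ring
  have h2 : e (σ + τ - z + τ * (r - ((r - s : ℚ) : ℂ)))
      = e (σ + τ) * e (τ * r) * (e (z + τ * (r - s)))⁻¹ := by
    rw [← e_neg, ← e_add, ← e_add]; congr 1; push_cast; ring
  have h3 : phiE r σ τ (σ + τ - z) (r - s) = -phiE r σ τ z s := by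
    rw [phiE, phiE]; push_cast; ring
  rw [lensGamma_eq hr hσ hτ, lensGamma_eq hr hσ hτ, h1, h2, h3,
    ellGamma_reflect (e_ne_zero _) (e_ne_zero _) (e_ne_zero _),
    ellGamma_reflect (e_ne_zero _) (e_ne_zero _) (e_ne_zero _), Complex.exp_neg, mul_inv, mul_inv]

theorem theta_add_int_mul {κ : ℂ} (hκ : 0 < κ.im) (u : ℂ) (m : ℤ) :
    theta (e (u + m * κ)) (e κ) = e (m / 2 - m * u - κ * (m * (m - 1) / 2)) * theta (e u) (e κ) := by
  have step : ∀ m : ℤ, theta (e (u + (m + 1 : ℤ) * κ)) (e κ)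
      = e (1 / 2 - u - m * κ) * theta (e (u + m * κ)) (e κ) := by
    intro m
    have h := theta_mul_base (norm_e_lt_one hκ) (e_ne_zero κ) (e_ne_zero (u + m * κ))
    rw [← e_add, ← e_neg, ← neg_one_mul, ← e_half, ← e_add] at h
    convert h using 3
    · push_cast; ring
    · ring
  induction m with
  | zero => simp [e_zero]
  | succ m ih =>
    rw [step, ih, ← mul_assoc, ← e_add]
    congr 2
    push_cast
    ring
  | pred m ih =>
    have h := step (-(m : ℤ) - 1)
    rw [show (-(m : ℤ) - 1 + 1) = -m by ring, ih] at h
    refine mul_left_cancel₀ (e_ne_zero _) (h.symm.trans ?_)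
    rw [← mul_assoc, ← e_add]
    congr 2
    push_cast
    ring

/-- The first gamma factor gains a theta function of base e(σ + τ), the second loses one of the same
base. Their arguments z + σm and z - τm differ by m(σ + τ), so the quotient is an exponential, and
φ_e compensates it. -/
theorem lensGamma_add_period (hr : 0 < r) (hσ : 0 < σ.im) (hτ : 0 < τ.im) {z : ℂ}
    (hz : z ∉ periodSet σ τ) (m : ℤ) :
    lensGamma r σ τ z ((m + r : ℤ) : ℚ) = lensGamma r σ τ z m := by
  have hr0 : (r : ℂ) ≠ 0 := by exact_mod_cast hr.ne'
  have hQ := norm_e_lt_one (im_add_pos hσ hτ)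
  have h3 : ∀ u, (∃ a b : ℤ, u = z + a * σ + b * τ) → qPoch (e u) (e (σ + τ)) ≠ 0 := by
    rintro u ⟨a, b, rfl⟩
    refine qPoch_ne_zero hQ fun j => ?_
    rw [← e_mul_nat, ← e_add]
    exact e_ne_one_of_notMem hz (a + j) (b + j) (by push_cast; ring)
  have h1 : e (z + σ * (((m + r : ℤ) : ℚ) : ℂ)) = e (z + σ * m) * e (σ * r) := by
    rw [← e_add]; congr 1; push_cast; ring
  have h2 : e (z + τ * (r - m)) = e (z + τ * (r - (((m + r : ℤ) : ℚ) : ℂ))) * e (τ * r) := by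
    rw [← e_add]; congr 1; push_cast; ring
  have h4 := ellGamma_mul_right hQ (norm_e_lt_one (im_mul_nat_pos hr hσ)) (e_ne_zero _)
    (e_ne_zero _) (h3 (z + σ * m) ⟨m, 0, by push_cast; ring⟩)
  have h5 := ellGamma_mul_right hQ (norm_e_lt_one (im_mul_nat_pos hr hτ)) (e_ne_zero _)
    (e_ne_zero _) (h3 (z + τ * (r - (((m + r : ℤ) : ℚ) : ℂ))) ⟨0, -m, by push_cast; ring⟩)
  have h6 := theta_add_int_mul (im_add_pos hσ hτ) (z + τ * (r - (((m + r : ℤ) : ℚ) : ℂ))) m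
  rw [show z + τ * (r - (((m + r : ℤ) : ℚ) : ℂ)) + m * (σ + τ) = z + σ * m by
    push_cast; ring] at h6
  rw [lensGamma_eq hr hσ hτ, lensGamma_eq hr hσ hτ, Rat.cast_intCast m, h1, h2, h4, h5, h6]
  -- The exponents differ by 2πi m(m-1)/2, which must be an integral multiple of 2πi.
  obtain ⟨c, hc⟩ : ∃ c : ℤ, m * (m - 1) = 2 * c := by
    obtain ⟨c, hc⟩ := Int.even_mul_pred_self m
    exact ⟨c, by rw [hc]; ring⟩
  have hc' : (m : ℂ) * (m - 1) = 2 * c := by exact_mod_cast hc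
  have h7 : Complex.exp (phiE r σ τ z ((m + r : ℤ) : ℚ)) *
      e (m / 2 - m * (z + τ * (r - (((m + r : ℤ) : ℚ) : ℂ))) - (σ + τ) * (m * (m - 1) / 2))
      = Complex.exp (phiE r σ τ z m) := by
    rw [e, ← Complex.exp_add, Complex.exp_eq_exp_iff_exists_int]
    refine ⟨-c, ?_⟩
    simp only [phiE]
    push_cast
    field_simp
    linear_combination (-6 * r : ℂ) * hc'
  rw [← h7]
  ring

theorem lensGamma_emod (hr : 0 < r) (hσ : 0 < σ.im) (hτ : 0 < τ.im) {z : ℂ}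
    (hz : z ∉ periodSet σ τ) (m : ℤ) :
    lensGamma r σ τ z m = lensGamma r σ τ z ((m % (r : ℤ) : ℤ) : ℚ) := by
  have h : Function.Periodic (fun m : ℤ => lensGamma r σ τ z m) (r : ℤ) := fun m =>
    lensGamma_add_period hr hσ hτ hz m
  have h2 := h.int_mul (m / (r : ℤ)) (m % (r : ℤ))
  rw [mul_comm, Int.cast_id, Int.emod_add_mul_ediv] at h2
  exact h2

end LensGamma

/-! ### Regularity of the integrand -/

section Regularity

variable {r : ℕ} {σ τ : ℂ}

/-- The discrete argument is replaced by its residue, for which `IsGammaPole` lists the zeros of the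
denominators. At another representative a pole of one factor may meet a zero of the other, and
division by zero then spoils the value. -/
theorem continuousAt_lensGamma (hr : 0 < r) (hσ : 0 < σ.im) (hτ : 0 < τ.im) {z : ℂ} {m : ℤ}
    (h : ¬ IsGammaPole r σ τ m z) :
    ContinuousAt (fun z => lensGamma r σ τ z ((m % (r : ℤ) : ℤ) : ℚ)) z := by
  simp only [lensGamma_eq hr hσ hτ]
  have he : ∀ c : ℂ, ContinuousAt (fun z => e (z + c)) z := fun c =>
    (continuous_e.comp (continuous_id.add continuous_const)).continuousAt
  refine ContinuousAt.mul (ContinuousAt.mul ?_ ?_) ?_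
  · unfold phiE
    fun_prop
  · refine ContinuousAt.comp (f := fun z => e (z + _))
      (g := fun w => ellGamma w (e (σ + τ)) (e (σ * r))) ?_ (he _)
    refine continuousAt_ellGamma (norm_e_lt_one (im_add_pos hσ hτ))
      (norm_e_lt_one (im_mul_nat_pos hr hσ)) (e_ne_zero _) fun j k hjk => h ?_
    rw [← e_mul_nat, ← e_mul_nat, ← e_add, ← e_add] at hjk
    obtain ⟨l, hl⟩ := e_eq_one_iff.1 hjk
    refine ⟨j, k, l, Or.inl ?_⟩
    rw [Int.floor_intCast]
    rw [Rat.cast_intCast] at hl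
    linear_combination hl
  · refine ContinuousAt.comp (f := fun z => e (z + _))
      (g := fun w => ellGamma w (e (σ + τ)) (e (τ * r))) ?_ (he _)
    refine continuousAt_ellGamma (norm_e_lt_one (im_add_pos hσ hτ))
      (norm_e_lt_one (im_mul_nat_pos hr hτ)) (e_ne_zero _) fun j k hjk => h ?_
    rw [← e_mul_nat, ← e_mul_nat, ← e_add, ← e_add] at hjk
    obtain ⟨l, hl⟩ := e_eq_one_iff.1 hjk
    refine ⟨j, k, l, Or.inr ?_⟩
    rw [Int.floor_intCast]
    rw [Rat.cast_intCast] at hl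
    linear_combination hl

theorem continuous_theta_e {κ : ℂ} (hκ : 0 < κ.im) : Continuous fun u => theta (e u) (e κ) :=
  (continuousOn_theta (norm_e_lt_one hκ)).comp_continuous continuous_e fun u => e_ne_zero u

theorem continuous_lensTheta (hr : 0 < r) (hσ : 0 < σ.im) (τ : ℂ) (s : ℚ) :
    Continuous fun z => lensTheta r σ τ z s := by
  simp only [lensTheta, ← e_add]
  refine Continuous.mul ?_ ?_
  · unfold phiSigma
    fun_prop
  · exact (continuous_theta_e (im_mul_nat_pos hr hσ)).comp (continuous_id.add continuous_const)

/-- The entire function `1 / (Γ(u, m) Γ(-u, -m))`. -/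
def gammaDenom (r : ℕ) (σ τ u : ℂ) (m : ℤ) : ℂ :=
  lensTheta r σ τ (u + σ) ((m - 1 : ℤ) : ℚ) *
    (Complex.exp (phiE r σ τ (u + σ) (m - 1) - phiE r σ τ u m) *
      theta (e (u + τ * (r - m))) (e (τ * r)))

theorem continuous_gammaDenom (hr : 0 < r) (hσ : 0 < σ.im) (hτ : 0 < τ.im) (m : ℤ) :
    Continuous fun u => gammaDenom r σ τ u m := by
  refine Continuous.mul ?_ (Continuous.mul ?_ ?_)
  · exact (continuous_lensTheta hr hσ τ _).comp (continuous_id.add continuous_const)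
  · unfold phiE
    fun_prop
  · exact (continuous_theta_e (im_mul_nat_pos hr hτ)).comp (continuous_id.add continuous_const)

/-- Reflection and periodicity give 1/Γ(-u, -m) = Γ(u + σ + τ, m). The steps T and (σ, -1) lead back
to Γ(u, m), which cancels and leaves only theta functions. -/
theorem inv_lensGamma_mul_lensGamma_neg (hr : 0 < r) (hσ : 0 < σ.im) (hτ : 0 < τ.im) {u : ℂ}
    (hu : u ∉ periodSet σ τ) (m : ℤ) :
    (lensGamma r σ τ u m * lensGamma r σ τ (-u) (-(m : ℚ)))⁻¹ = gammaDenom r σ τ u m := by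
  have h1 := lensGamma_reflect hr hσ hτ (-u) (-(m : ℚ))
  have hu1 : u + σ ∉ periodSet σ τ := notMem_periodSet_add hu 1 0 (by push_cast; ring)
  have hu2 : u + σ + τ ∉ periodSet σ τ := notMem_periodSet_add hu 1 1 (by push_cast; ring)
  have h2 := lensGamma_add_period hr hσ hτ hu2 m
  have h3 := lensGamma_shift_tau hr hσ hτ hu1 (m - 1)
  have h4 := lensGamma_shift_sigma hr hσ hτ hu m
  have h0 := lensGamma_ne_zero hr hσ hτ hu m
  have e1 : σ + τ - -u = u + σ + τ := by ring
  have e2 : ((r : ℚ) - -(m : ℚ)) = ((m + r : ℤ) : ℚ) := by push_cast; ring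
  have e3 : (((m - 1 : ℤ) : ℚ) + 1) = m := by push_cast; ring
  have e4 : ((m - 1 : ℤ) : ℚ) = (m : ℚ) - 1 := by push_cast; ring
  rw [e1, e2, h2] at h1
  rw [e3, e4, h4] at h3
  rw [mul_inv, ← h1, h3, gammaDenom, e4]
  field_simp

/-- The set of `z` at which the integrand may differ from its analytic continuation. -/
def exceptionalSet (σ τ : ℂ) (X : Point) : Set ℂ :=
  (⋃ j, {z | X.1 j + z ∈ periodSet σ τ} ∪ {z | X.1 j - z ∈ periodSet σ τ}) ∪
    {z | 2 * z ∈ periodSet σ τ}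

theorem countable_exceptionalSet (σ τ : ℂ) (X : Point) : (exceptionalSet σ τ X).Countable := by
  have h := countable_periodSet σ τ
  refine Set.Countable.union (Set.countable_iUnion fun j => Set.Countable.union ?_ ?_) ?_
  · exact h.preimage (f := fun z => X.1 j + z) (add_right_injective _)
  · exact h.preimage (f := fun z => X.1 j - z) (sub_right_injective)
  · exact h.preimage (f := fun z : ℂ => 2 * z) (mul_right_injective₀ two_ne_zero)

theorem notMem_exceptionalSet {X : Point} {z : ℂ} (hz : z ∉ exceptionalSet σ τ X) :
    (∀ j, X.1 j + z ∉ periodSet σ τ ∧ X.1 j - z ∉ periodSet σ τ) ∧ 2 * z ∉ periodSet σ τ :=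
  ⟨fun j => ⟨fun h => hz (Or.inl (Set.mem_iUnion.2 ⟨j, Or.inl h⟩)),
    fun h => hz (Or.inl (Set.mem_iUnion.2 ⟨j, Or.inr h⟩))⟩, fun h => hz (Or.inr h)⟩

/-- The discrete arguments of the gamma functions in the integrand are integers. -/
structure IntegralAt (X : Point) (s : ℚ) (m m' : Fin 8 → ℤ) (d : ℤ) : Prop where
  add : ∀ j, X.2 j + s = m j
  sub : ∀ j, X.2 j - s = m' j
  double : 2 * s = d

/-- The integrand with its removable singularities removed. -/
def regularIntegrand (r : ℕ) (σ τ : ℂ) (X : Point) (m m' : Fin 8 → ℤ) (d : ℤ) (z : ℂ) : ℂ :=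
  (∏ j, (lensGamma r σ τ (X.1 j + z) ((m j % (r : ℤ) : ℤ) : ℚ) *
    lensGamma r σ τ (X.1 j - z) ((m' j % (r : ℤ) : ℤ) : ℚ))) * gammaDenom r σ τ (2 * z) d

theorem integrand_eq_regularIntegrand (hr : 0 < r) (hσ : 0 < σ.im) (hτ : 0 < τ.im) {X : Point}
    {s : ℚ} {m m' : Fin 8 → ℤ} {d : ℤ} (hX : IntegralAt X s m m' d) {z : ℂ}
    (hz : z ∉ exceptionalSet σ τ X) :
    integrand r σ τ X z s = regularIntegrand r σ τ X m m' d z := by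
  obtain ⟨h1, h2⟩ := notMem_exceptionalSet hz
  rw [integrand, regularIntegrand, hX.double, div_eq_mul_inv,
    inv_lensGamma_mul_lensGamma_neg hr hσ hτ h2]
  congr 1
  refine Finset.prod_congr rfl fun j _ => ?_
  rw [hX.add, hX.sub, lensGamma_emod hr hσ hτ (h1 j).1, lensGamma_emod hr hσ hτ (h1 j).2]

theorem continuousAt_regularIntegrand (hr : 0 < r) (hσ : 0 < σ.im) (hτ : 0 < τ.im) {X : Point}
    {m m' : Fin 8 → ℤ} {d : ℤ} {z : ℂ} (h : ∀ j, ¬ IsGammaPole r σ τ (m j) (X.1 j + z))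
    (h' : ∀ j, ¬ IsGammaPole r σ τ (m' j) (X.1 j - z)) :
    ContinuousAt (regularIntegrand r σ τ X m m' d) z := by
  refine ContinuousAt.mul (tendsto_finsetProd _ fun j _ => ContinuousAt.mul ?_ ?_) ?_
  · exact ContinuousAt.comp (f := fun z => X.1 j + z) (continuousAt_lensGamma hr hσ hτ (h j))
      (by fun_prop)
  · exact ContinuousAt.comp (f := fun z => X.1 j - z) (continuousAt_lensGamma hr hσ hτ (h' j))
      (by fun_prop)
  · exact ((continuous_gammaDenom hr hσ hτ d).comp (continuous_const.mul continuous_id)).continuousAt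

end Regularity

/-! ### Integration along a contour -/

section ContourIntegral

open MeasureTheory

/-- A point of nonzero derivative is isolated in its level set, and a discrete subset of the line is
countable. -/
theorem countable_setOf_eq_deriv_ne_zero (f : ℝ → ℂ) (p : ℂ) :
    {t | f t = p ∧ deriv f t ≠ 0}.Countable := by
  have : DiscreteTopology {t | f t = p ∧ deriv f t ≠ 0} := by
    rw [discreteTopology_subtype_iff]
    rintro t ⟨-, ht⟩
    have hd : HasDerivAt f (deriv f t) t := by
      -- `deriv` is 0 where f is not differentiable, so a nonzero value implies differentiability.
      by_contra h
      exact ht (deriv_zero_of_not_differentiableAt fun h' => h h'.hasDerivAt)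
    have h := hd.eventually_ne (c := p) ht
    rw [← disjoint_iff, Filter.disjoint_principal_right]
    filter_upwards [h] with x hx h1
    exact hx h1.1
  exact Set.countable_coe_iff.1 countable_of_Lindelof_of_discrete

theorem countable_setOf_mem_deriv_ne_zero (f : ℝ → ℂ) {E : Set ℂ} (hE : E.Countable) :
    {t | f t ∈ E ∧ deriv f t ≠ 0}.Countable := by
  have : {t | f t ∈ E ∧ deriv f t ≠ 0} = ⋃ p ∈ E, {t | f t = p ∧ deriv f t ≠ 0} := by
    ext t; simp
  rw [this]
  exact hE.biUnion fun p _ => countable_setOf_eq_deriv_ne_zero f p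

/-- The curve may stay in E for a time of positive measure, but there the derivative is zero outside
a countable set of t. -/
theorem ae_mul_deriv_eq (f : ℝ → ℂ) {E : Set ℂ} (hE : E.Countable) {g G : ℂ → ℂ}
    (h : ∀ z ∉ E, g z = G z) : ∀ᵐ t, g (f t) * deriv f t = G (f t) * deriv f t := by
  filter_upwards [(countable_setOf_mem_deriv_ne_zero f hE).ae_notMem volume] with t ht
  by_cases hd : deriv f t = 0
  · rw [hd, mul_zero, mul_zero]
  · rw [h _ fun hm => ht ⟨hm, hd⟩]

theorem Contour.intervalIntegrable_deriv (C : Contour) :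
    IntervalIntegrable (deriv C.toFun) volume 0 1 := by
  obtain ⟨F, M, hM⟩ := C.piecewise
  rw [intervalIntegrable_iff_integrableOn_Icc_of_le zero_le_one]
  refine Measure.integrableOn_of_bounded (M := M) (by simp)
    (measurable_deriv _).aestronglyMeasurable ?_
  rw [ae_restrict_iff' measurableSet_Icc]
  filter_upwards [F.countable_toSet.ae_notMem volume] with t ht hI
  exact (hM t hI (by simpa using ht)).2

theorem Contour.intervalIntegrable_mul_deriv (C : Contour) {E : Set ℂ} (hE : E.Countable)
    {g G : ℂ → ℂ} (h : ∀ z ∉ E, g z = G z)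
    (hG : ∀ t ∈ Set.Icc (0 : ℝ) 1, ContinuousAt G (C.toFun t)) :
    IntervalIntegrable (fun t => g (C.toFun t) * deriv C.toFun t) volume 0 1 := by
  have h1 : ContinuousOn (fun t => G (C.toFun t)) (Set.uIcc 0 1) := by
    rw [Set.uIcc_of_le zero_le_one]
    intro t ht
    exact (hG t ht).comp_continuousWithinAt (C.continuousOn t ht)
  refine (C.intervalIntegrable_deriv.continuousOn_mul h1).congr_ae ?_
  exact ae_restrict_of_ae ((ae_mul_deriv_eq C.toFun hE h).mono fun t ht => ht.symm)

theorem Contour.notMem_trace_of_below {C : Contour} {p : ℂ} (h : C.Below p) : p ∉ C.trace := by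
  obtain ⟨q, -, hq⟩ := h
  exact hq.source_mem

theorem Contour.notMem_trace_of_above {C : Contour} {p : ℂ} (h : C.Above p) : p ∉ C.trace := by
  obtain ⟨q, -, hq⟩ := h
  exact hq.source_mem

theorem Contour.mem_trace (C : Contour) {t : ℝ} (ht : t ∈ Set.Icc (0 : ℝ) 1) :
    C.toFun t ∈ C.trace := ⟨t, ht, 0, by simp⟩

/-- Admissibility keeps all poles off the contour, so the regularised integrand is continuous along
it and multiplies an integrable derivative. -/
theorem intervalIntegrable_integrand {r : ℕ} {σ τ : ℂ} (hr : 0 < r) (hσ : 0 < σ.im)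
    (hτ : 0 < τ.im) {X : Point} {C : Contour} (hC : Admissible r σ τ X C) {k : ℕ} (hk : k < r)
    {m m' : Fin 8 → ℤ} {d : ℤ} (hX : IntegralAt X (discVar r X.2 k) m m' d) :
    IntervalIntegrable (fun t => integrand r σ τ X (C.toFun t) (discVar r X.2 k) *
      deriv C.toFun t) volume 0 1 := by
  refine C.intervalIntegrable_mul_deriv (g := fun z => integrand r σ τ X z (discVar r X.2 k))
    (countable_exceptionalSet σ τ X)
    (fun z hz => integrand_eq_regularIntegrand hr hσ hτ hX hz) fun t ht => ?_
  have hk' := Finset.mem_range.2 hk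
  refine continuousAt_regularIntegrand hr hσ hτ (fun j hj => ?_) fun j hj => ?_
  · rw [← hX.add] at hj
    exact Contour.notMem_trace_of_below ((hC k hk' j _).1 hj) (C.mem_trace ht)
  · rw [← hX.sub] at hj
    exact Contour.notMem_trace_of_above ((hC k hk' j _).2 hj) (C.mem_trace ht)

end ContourIntegral

/-! ### Shifts by multiples of `T` -/

section Shifts

variable {r : ℕ} {σ τ : ℂ}

/-- The list form of a simple fact: Γ(z + τ, s + 1) = θ_σ Γ(z, s) with θ_σ entire, so a step T
creates no poles. Hence one contour serves all matrix entries. -/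
theorem IsGammaPole.of_shift (hr : 0 < r) {s : ℚ} {p : ℂ}
    (h : IsGammaPole r σ τ (s + 1) (p + τ)) : IsGammaPole r σ τ s p := by
  have hr' : (0 : ℤ) < r := by exact_mod_cast hr
  obtain ⟨j, k, l, h⟩ := h
  rw [Int.floor_add_one] at h
  have h0 := Int.emod_nonneg ⌊s⌋ hr'.ne'
  have h1 := Int.emod_lt_of_pos ⌊s⌋ hr'
  have h2 : (⌊s⌋ + 1) % (r : ℤ) = (⌊s⌋ % (r : ℤ) + 1) % (r : ℤ) := (Int.emod_add_emod _ _ _).symm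
  rw [h2] at h
  unfold IsGammaPole
  generalize ⌊s⌋ % (r : ℤ) = ρ at h h0 h1 ⊢
  by_cases hρ : ρ + 1 < r
  · rw [Int.emod_eq_of_lt (by omega) hρ] at h
    push_cast at h
    rcases h with h | h
    · exact ⟨j + 1, k, l, Or.inl (by push_cast; linear_combination h)⟩
    · exact ⟨j, k, l, Or.inr (by linear_combination h)⟩
  -- The residue wraps from r - 1 to 0. The shifted poles of the first family with k = 0 then
  -- correspond to unshifted poles of the second family.
  · have hρ' : (ρ : ℂ) = r - 1 := by
      have : ρ = r - 1 := by omega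
      rw [this]; push_cast; ring
    rw [show ρ + 1 = r by omega, Int.emod_self] at h
    push_cast at h
    rw [hρ']
    rcases h with h | h
    · rcases k with _ | k
      · exact ⟨j, 0, l, Or.inr (by push_cast at h ⊢; linear_combination h)⟩
      · exact ⟨j + 1, k, l, Or.inl (by push_cast at h ⊢; linear_combination h)⟩
    · exact ⟨j, k + 1, l, Or.inr (by push_cast; linear_combination h)⟩

/-- The point with its variables shifted by the multiples `c_j T`. -/
def shiftNat (τ : ℂ) (X : Point) (c : Fin 8 → ℕ) : Point :=
  (fun j => X.1 j + c j * τ, fun j => X.2 j + c j)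

theorem IsGammaPole.of_shift_nat (hr : 0 < r) {s : ℚ} {p : ℂ} (c : ℕ)
    (h : IsGammaPole r σ τ (s + c) (p + c * τ)) : IsGammaPole r σ τ s p := by
  induction c with
  | zero => simpa using h
  | succ c ih =>
    refine ih (IsGammaPole.of_shift hr ?_)
    convert h using 1 <;> push_cast <;> ring

theorem discVar_shiftNat (r : ℕ) (τ : ℂ) (X : Point) (c : Fin 8 → ℕ) (k : ℕ) :
    discVar r (shiftNat τ X c).2 k = discVar r X.2 k := by
  simp [discVar, shiftNat]

theorem Admissible.shiftNat (hr : 0 < r) {X : Point} {C : Contour} (hC : Admissible r σ τ X C)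
    (c : Fin 8 → ℕ) : Admissible r σ τ (shiftNat τ X c) C := by
  intro k hk j z
  rw [discVar_shiftNat]
  refine ⟨fun h => (hC k hk j z).1 (IsGammaPole.of_shift_nat hr (c j) ?_),
    fun h => (hC k hk j z).2 (IsGammaPole.of_shift_nat hr (c j) ?_)⟩
  · convert h using 1 <;> simp only [LensTau.shiftNat] <;> ring
  · convert h using 1 <;> simp only [LensTau.shiftNat] <;> ring

theorem lensGamma_shift_nat (hr : 0 < r) (hσ : 0 < σ.im) (hτ : 0 < τ.im) {z : ℂ}
    (hz : z ∉ periodSet σ τ) (m : ℤ) (c : ℕ) :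
    lensGamma r σ τ (z + c * τ) (m + c) = lensThetaPoch r σ τ z m c * lensGamma r σ τ z m := by
  induction c with
  | zero => simp [lensThetaPoch]
  | succ c ih =>
    have hz' : z + c * τ ∉ periodSet σ τ := notMem_periodSet_add hz 0 c (by push_cast; ring)
    have h := lensGamma_shift_tau hr hσ hτ hz' (m + c)
    rw [lensThetaPoch, Finset.prod_range_succ, mul_assoc, mul_comm (lensTheta _ _ _ _ _),
      ← mul_assoc]
    rw [lensThetaPoch] at ih
    rw [← ih, mul_comm (lensGamma _ _ _ _ _)]
    convert h using 2 <;> push_cast <;> ring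

/-- `θ_σ(x_j ± z, 𝐱_j ± s)_c`. -/
def thetaPochPair (r : ℕ) (σ τ : ℂ) (X : Point) (j : Fin 8) (c : ℕ) (z : ℂ) (s : ℚ) : ℂ :=
  lensThetaPoch r σ τ (X.1 j + z) (X.2 j + s) c * lensThetaPoch r σ τ (X.1 j - z) (X.2 j - s) c

theorem integrand_shiftNat (hr : 0 < r) (hσ : 0 < σ.im) (hτ : 0 < τ.im) {X : Point}
    {s : ℚ} {m m' : Fin 8 → ℤ} {d : ℤ} (hX : IntegralAt X s m m' d) (c : Fin 8 → ℕ) {z : ℂ}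
    (hz : z ∉ exceptionalSet σ τ X) :
    integrand r σ τ (shiftNat τ X c) z s
      = (∏ j, thetaPochPair r σ τ X j (c j) z s) * integrand r σ τ X z s := by
  obtain ⟨h1, -⟩ := notMem_exceptionalSet hz
  rw [integrand, integrand, ← mul_div_assoc, ← Finset.prod_mul_distrib]
  congr 1
  refine Finset.prod_congr rfl fun j _ => ?_
  have ha := lensGamma_shift_nat hr hσ hτ (h1 j).1 (m j) (c j)
  have hb := lensGamma_shift_nat hr hσ hτ (h1 j).2 (m' j) (c j)
  rw [thetaPochPair, hX.add, hX.sub]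
  have e1 : (shiftNat τ X c).1 j + z = X.1 j + z + c j * τ := by simp only [shiftNat]; ring
  have e2 : (shiftNat τ X c).1 j - z = X.1 j - z + c j * τ := by simp only [shiftNat]; ring
  have e3 : (shiftNat τ X c).2 j + s = m j + c j := by
    rw [← hX.add]; simp only [shiftNat]; ring
  have e4 : (shiftNat τ X c).2 j - s = m' j + c j := by
    rw [← hX.sub]; simp only [shiftNat]; ring
  rw [e1, e2, e3, e4, ha, hb]
  ring

/-- The shifts of `X̃` induced by `X ↦ X + v_{ij} T`. -/
def tildeShift (n i j : ℕ) : Fin 8 → ℕ := ![n - i, n - j, j - 1, i - 1, 0, 0, 0, 0]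

theorem frameShift_eq (n i j : ℤ) : frameShift n i j
    = ![(1 - i : ℚ), 1 - j, j - n, i - n, 0, 0, 0, 0] := by
  ext a
  fin_cases a <;> simp [frameShift, frame] <;> ring

theorem sum_block_zero {M : Type*} [AddCommMonoid M] (f : Fin 8 → M) {i : Fin 8} (hi : i < 4) :
    ∑ j ∈ Finset.univ.filter (fun j : Fin 8 => j < 4 ↔ i < 4), f j = f 0 + f 1 + f 2 + f 3 := by
  have : Finset.univ.filter (fun j : Fin 8 => j < 4 ↔ i < 4) = {0, 1, 2, 3} := by
    simp only [hi, iff_true]; decide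
  rw [this]
  simp [add_assoc]

theorem sum_block_one {M : Type*} [AddCommMonoid M] (f : Fin 8 → M) {i : Fin 8} (hi : ¬ i < 4) :
    ∑ j ∈ Finset.univ.filter (fun j : Fin 8 => j < 4 ↔ i < 4), f j = f 4 + f 5 + f 6 + f 7 := by
  have : Finset.univ.filter (fun j : Fin 8 => j < 4 ↔ i < 4) = {4, 5, 6, 7} := by
    simp only [hi, iff_false]; decide
  rw [this]
  simp [add_assoc]

/-- The first block of v_ij sums to 2 - 2n, so the transform adds n - 1 to each of 1-i, 1-j, j-n,
i-n, making them natural numbers. The second block does not move. -/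
theorem tilde_shiftT (r : ℕ) (σ τ : ℂ) (X : Point) {n i j : ℕ} (hi : i ∈ Finset.Icc 1 n)
    (hj : j ∈ Finset.Icc 1 n) : tilde r σ τ (shiftT τ X (frameShift n i j))
      = shiftNat τ (tilde r σ τ X) (tildeShift n i j) := by
  rw [Finset.mem_Icc] at hi hj
  have a1 : ((n - i : ℕ) : ℚ) = n - i := Nat.cast_sub hi.2
  have a2 : ((n - j : ℕ) : ℚ) = n - j := Nat.cast_sub hj.2
  have a3 : ((i - 1 : ℕ) : ℚ) = i - 1 := by rw [Nat.cast_sub hi.1]; simp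
  have a4 : ((j - 1 : ℕ) : ℚ) = j - 1 := by rw [Nat.cast_sub hj.1]; simp
  have b1 : ((n - i : ℕ) : ℂ) = n - i := Nat.cast_sub hi.2
  have b2 : ((n - j : ℕ) : ℂ) = n - j := Nat.cast_sub hj.2
  have b3 : ((i - 1 : ℕ) : ℂ) = i - 1 := by rw [Nat.cast_sub hi.1]; simp
  have b4 : ((j - 1 : ℕ) : ℂ) = j - 1 := by rw [Nat.cast_sub hj.1]; simp
  have l4 : ∀ a : Fin 8, a < 4 ∨ ¬ a < 4 := fun a => em _
  refine Prod.ext (funext fun a => ?_) (funext fun a => ?_)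
  · rcases l4 a with ha | ha
    · simp only [tilde, shiftT, shiftNat, sum_block_zero _ ha, frameShift_eq]
      fin_cases a <;> simp [tildeShift, b1, b2, b3, b4] at ha ⊢ <;> ring
    · simp only [tilde, shiftT, shiftNat, sum_block_one _ ha, frameShift_eq]
      fin_cases a <;> simp [tildeShift] at ha ⊢
  · rcases l4 a with ha | ha
    · simp only [tilde, shiftT, shiftNat, sum_block_zero _ ha, frameShift_eq]
      fin_cases a <;> simp [tildeShift, a1, a2, a3, a4] at ha ⊢ <;> ring
    · simp only [tilde, shiftT, shiftNat, sum_block_one _ ha, frameShift_eq]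
      fin_cases a <;> simp [tildeShift] at ha ⊢

end Shifts

/-! ### The lattice -/

section Lattice

variable {r : ℕ} {σ τ : ℂ}

/-- Integrality of the gamma arguments needs just this: the coordinates lie in ½ℤ and differ by
integers. -/
theorem exists_int_of_mem_latticeE8 {v : Fin 8 → ℚ} (hv : v ∈ latticeE8) :
    ∃ (a : Fin 8 → ℤ) (b : ℤ), ∀ i, v i = a i + b / 2 := by
  induction hv using Submodule.span_induction with
  | mem x hx =>
    rcases hx with ⟨i, j, ε, δ, -, rfl⟩ | ⟨ε, -, rfl⟩
    · refine ⟨Pi.single i (ε : ℤ) + Pi.single j (δ : ℤ), 0, fun l => ?_⟩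
      simp [Pi.single_apply, apply_ite (Int.cast : ℤ → ℚ)]
    · refine ⟨fun i => if ε i = 1 then 0 else -1, 1, fun i => ?_⟩
      rcases Int.units_eq_one_or (ε i) with h | h
      · simp [h]
      · simp [h]; norm_num
  | zero => exact ⟨0, 0, fun i => by simp⟩
  | add x y _ _ hx hy =>
    obtain ⟨a, b, h⟩ := hx
    obtain ⟨a', b', h'⟩ := hy
    refine ⟨a + a', b + b', fun i => ?_⟩
    rw [Pi.add_apply, h, h', Pi.add_apply]
    push_cast
    ring
  | smul c x _ hx =>
    obtain ⟨a, b, h⟩ := hx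
    refine ⟨c • a, c * b, fun i => ?_⟩
    rw [Pi.smul_apply, h, Pi.smul_apply]
    simp only [zsmul_eq_mul, smul_eq_mul]
    push_cast
    ring

/-- The condition on the total sum in `domainD` expresses the half sum of the second block through
that of the first, up to an integer, so both blocks land in the same class. -/
theorem exists_int_tilde {n : ℤ} {X : Point} (hX : X ∈ domainD r σ τ n) :
    ∃ (a : Fin 8 → ℤ) (b : ℤ), ∀ i, (tilde r σ τ X).2 i = a i + b / 2 := by
  obtain ⟨-, h2, h3⟩ := hX
  obtain ⟨a, b, h⟩ := exists_int_of_mem_latticeE8 h3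
  simp only [Fin.sum_univ_eight, h] at h2
  have h4 : a 4 + a 5 + a 6 + a 7 = 2 * (n + r - 1 - 2 * b) - (a 0 + a 1 + a 2 + a 3) := by
    have : ((a 4 + a 5 + a 6 + a 7 : ℤ) : ℚ)
        = (2 * (n + r - 1 - 2 * b) - (a 0 + a 1 + a 2 + a 3) : ℤ) := by
      push_cast
      linear_combination 2 * h2
    exact_mod_cast this
  have h4' : (a 4 + a 5 + a 6 + a 7 : ℚ) = 2 * (n + r - 1 - 2 * b) - (a 0 + a 1 + a 2 + a 3) := by
    exact_mod_cast h4
  refine ⟨fun i => a i - b + if i < 4 then 0 else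
      (a 0 + a 1 + a 2 + a 3) - (n + r - 1 - 2 * b),
    b + r - (a 0 + a 1 + a 2 + a 3), fun i => ?_⟩
  by_cases hi : i < 4
  · simp only [tilde, sum_block_zero _ hi, h, if_pos hi]
    push_cast
    ring
  · simp only [tilde, sum_block_one _ hi, h, if_neg hi]
    push_cast
    linear_combination (-1 / 2) * h4'

theorem exists_integralAt {Y : Point} {a : Fin 8 → ℤ} {b : ℤ} (h : ∀ i, Y.2 i = a i + b / 2)
    (k : ℕ) : ∃ m m' d, IntegralAt Y (discVar r Y.2 k) m m' d := by
  rcases Int.even_or_odd' b with ⟨c, rfl | rfl⟩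
  · have h1 : ∀ i, Y.2 i = (a i + c : ℤ) := fun i => by rw [h]; push_cast; ring
    have hd : discVar r Y.2 k = k := by rw [discVar, h1, Int.fract_intCast]; simp
    refine ⟨fun i => a i + c + k, fun i => a i + c - k, 2 * k, fun j => ?_, fun j => ?_, ?_⟩
    · rw [hd, h1]; push_cast; ring
    · rw [hd, h1]; push_cast; ring
    · rw [hd]; push_cast; ring
  · have h1 : ∀ i, Y.2 i = 1 / 2 + (a i + c : ℤ) := fun i => by rw [h]; push_cast; ring
    -- The number r + ((r+1) mod 2) is odd for every r, so the summation variable is a half-integer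
    -- exactly when the 𝐱_j are.
    obtain ⟨o, ho⟩ : ∃ o : ℕ, r + (r + 1) % 2 = 2 * o + 1 := ⟨r / 2, by omega⟩
    have hd : discVar r Y.2 k = k + o + 1 / 2 := by
      have hf : Int.fract (1 / 2 : ℚ) = 1 / 2 := Int.fract_eq_self.2 ⟨by norm_num, by norm_num⟩
      have ho' : ((r : ℚ) + ((r + 1) % 2 : ℕ)) = 2 * o + 1 := by exact_mod_cast ho
      rw [discVar, h1, Int.fract_add_intCast, hf, ho']
      ring
    refine ⟨fun i => a i + c + k + o + 1, fun i => a i + c - k - o, 2 * k + 2 * o + 1,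
      fun j => ?_, fun j => ?_, ?_⟩
    · rw [hd, h1]; push_cast; ring
    · rw [hd, h1]; push_cast; ring
    · rw [hd]; push_cast; ring

theorem frameShift_mem_latticeE8 (n i j : ℤ) : frameShift n i j ∈ latticeE8 := by
  have hroot : ∀ (a b : Fin 8) (ε δ : ℤˣ), a < b →
      (Pi.single a (((ε : ℤ)) : ℚ) + Pi.single b (((δ : ℤ)) : ℚ) : Fin 8 → ℚ) ∈ latticeE8 :=
    fun a b ε δ hab => Submodule.subset_span (Or.inl ⟨a, b, ε, δ, hab, rfl⟩)
  have h : frameShift n i j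
      = (1 - i) • (Pi.single 0 (((1 : ℤˣ) : ℤ) : ℚ) + Pi.single 3 (((-1 : ℤˣ) : ℤ) : ℚ)
          : Fin 8 → ℚ)
        + (1 - j) • (Pi.single 1 (((1 : ℤˣ) : ℤ) : ℚ) + Pi.single 2 (((-1 : ℤˣ) : ℤ) : ℚ)
          : Fin 8 → ℚ)
        + (1 - n) • (Pi.single 2 (((1 : ℤˣ) : ℤ) : ℚ) + Pi.single 3 (((1 : ℤˣ) : ℤ) : ℚ)
          : Fin 8 → ℚ) := by
    rw [frameShift_eq]
    ext a
    fin_cases a <;> simp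
  rw [h]
  exact add_mem (add_mem (latticeE8.smul_mem _ (hroot 0 3 _ _ (by decide)))
    (latticeE8.smul_mem _ (hroot 1 2 _ _ (by decide))))
    (latticeE8.smul_mem _ (hroot 2 3 _ _ (by decide)))

theorem shiftT_mem_domainD {X : Point} {n : ℕ} (hX : X ∈ domainD r σ τ n) (i j : ℤ) :
    shiftT τ X (frameShift n i j) ∈ domainD r σ τ 1 := by
  obtain ⟨h1, h2, h3⟩ := hX
  refine ⟨?_, ?_, add_mem h3 (frameShift_mem_latticeE8 n i j)⟩
  · simp only [Fin.sum_univ_eight] at h1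
    simp only [shiftT, frameShift_eq, Fin.sum_univ_eight]
    simp
    push_cast at h1
    linear_combination h1
  · simp only [Fin.sum_univ_eight] at h2
    simp only [shiftT, frameShift_eq, Fin.sum_univ_eight]
    simp
    push_cast at h2
    linear_combination h2

end Lattice

/-! ### The determinant as a multiple integral -/

section PsiMatrix

open MeasureTheory

variable {r : ℕ} {σ τ : ℂ}

/-- The functions `θ_σ(x_a ± z)_{n-1-i} θ_σ(x_b ± z)_i` that span the rows of the determinant. -/
def thetaRow (r : ℕ) (σ τ : ℂ) (n : ℕ) (Y : Point) (a b : Fin 8) (i : ℕ) (z : ℂ) (s : ℚ) : ℂ :=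
  thetaPochPair r σ τ Y a (n - 1 - i) z s * thetaPochPair r σ τ Y b i z s

theorem continuous_thetaPochPair (hr : 0 < r) (hσ : 0 < σ.im) (τ : ℂ) (Y : Point) (a : Fin 8)
    (c : ℕ) (s : ℚ) : Continuous fun z => thetaPochPair r σ τ Y a c z s := by
  refine Continuous.mul ?_ ?_
  · exact continuous_finsetProd _ fun j _ => (continuous_lensTheta hr hσ τ _).comp
      ((continuous_const.add continuous_id).add continuous_const)
  · exact continuous_finsetProd _ fun j _ => (continuous_lensTheta hr hσ τ _).comp
      ((continuous_const.sub continuous_id).add continuous_const)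

theorem continuous_thetaRow (hr : 0 < r) (hσ : 0 < σ.im) (τ : ℂ) (n : ℕ) (Y : Point)
    (a b : Fin 8) (i : ℕ) (s : ℚ) : Continuous fun z => thetaRow r σ τ n Y a b i z s :=
  (continuous_thetaPochPair hr hσ τ Y a _ s).mul (continuous_thetaPochPair hr hσ τ Y b _ s)

/-- The separation of row and column index that Andréief's identity requires. -/
theorem prod_thetaPochPair_tildeShift {n : ℕ} (i j : Fin n) (Y : Point) (z : ℂ) (s : ℚ) :
    ∏ a, thetaPochPair r σ τ Y a (tildeShift n (i + 1) (j + 1) a) z s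
      = thetaRow r σ τ n Y 0 3 i z s * thetaRow r σ τ n Y 1 2 j z s := by
  have h1 : n - ((i : ℕ) + 1) = n - 1 - i := by omega
  have h2 : n - ((j : ℕ) + 1) = n - 1 - j := by omega
  have h0 : ∀ a, thetaPochPair r σ τ Y a 0 z s = 1 := fun a => by
    simp [thetaPochPair, lensThetaPoch]
  simp [Fin.prod_univ_eight, tildeShift, h0, h1, h2, thetaRow]
  ring

theorem integrableOn_thetaRow_integrand (hr : 0 < r) (hσ : 0 < σ.im) (hτ : 0 < τ.im) (n : ℕ)
    {Y : Point} {a : Fin 8 → ℤ} {b : ℤ} (hY : ∀ i, Y.2 i = a i + b / 2) {C : Contour}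
    (hC : Admissible r σ τ Y C) (i j : ℕ) {k : ℕ} (hk : k < r) :
    IntegrableOn (fun t => thetaRow r σ τ n Y 0 3 i (C.toFun t) (discVar r Y.2 k) *
      thetaRow r σ τ n Y 1 2 j (C.toFun t) (discVar r Y.2 k) *
      (integrand r σ τ Y (C.toFun t) (discVar r Y.2 k) * deriv C.toFun t)) (Set.Icc 0 1) := by
  obtain ⟨m, m', d, hI⟩ := exists_integralAt (r := r) hY k
  have h := intervalIntegrable_integrand hr hσ hτ hC hk hI
  rw [← intervalIntegrable_iff_integrableOn_Icc_of_le zero_le_one]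
  refine h.continuousOn_mul ?_
  rw [Set.uIcc_of_le zero_le_one]
  exact (((continuous_thetaRow hr hσ τ n Y 0 3 i _).mul
    (continuous_thetaRow hr hσ τ n Y 1 2 j _)).comp_continuousOn C.continuousOn)

theorem psiMatrix_apply (hr : 0 < r) (hσ : 0 < σ.im) (hτ : 0 < τ.im) (n : ℕ) {X : Point}
    {a : Fin 8 → ℤ} {b : ℤ} (hX : ∀ i, (tilde r σ τ X).2 i = a i + b / 2) (C : Contour)
    (i j : Fin n) :
    psiMatrix r σ τ C n X i j = lam r σ τ / 2 * ∑ k : Fin r, ∫ t in Set.Icc (0 : ℝ) 1,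
      thetaRow r σ τ n (tilde r σ τ X) 0 3 i (C.toFun t) (discVar r (tilde r σ τ X).2 k) *
      thetaRow r σ τ n (tilde r σ τ X) 1 2 j (C.toFun t) (discVar r (tilde r σ τ X).2 k) *
      (integrand r σ τ (tilde r σ τ X) (C.toFun t) (discVar r (tilde r σ τ X).2 k) *
        deriv C.toFun t) := by
  have hi : (i : ℕ) + 1 ∈ Finset.Icc 1 n := Finset.mem_Icc.2 ⟨by omega, i.2⟩
  have hj : (j : ℕ) + 1 ∈ Finset.Icc 1 n := Finset.mem_Icc.2 ⟨by omega, j.2⟩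
  have ht := tilde_shiftT r σ τ X hi hj
  push_cast at ht
  rw [psiMatrix, psi, sumIntegral, ht, Finset.sum_range]
  congr 1
  refine Finset.sum_congr rfl fun k _ => ?_
  obtain ⟨m, m', d, hI⟩ := exists_integralAt (r := r) hX k
  rw [discVar_shiftNat, intervalIntegral.integral_of_le zero_le_one, ← integral_Icc_eq_integral_Ioc]
  refine integral_congr_ae (ae_restrict_of_ae ?_)
  refine (ae_mul_deriv_eq C.toFun (countable_exceptionalSet σ τ (tilde r σ τ X))
    fun z hz => integrand_shiftNat hr hσ hτ hI (tildeShift n (i + 1) (j + 1)) hz).mono fun t h => ?_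
  rw [prod_thetaPochPair_tildeShift] at h
  dsimp only
  rw [h, mul_assoc]

theorem det_psiMatrix (hr : 0 < r) (hσ : 0 < σ.im) (hτ : 0 < τ.im) (n : ℕ) {X : Point}
    {a : Fin 8 → ℤ} {b : ℤ} (hX : ∀ i, (tilde r σ τ X).2 i = a i + b / 2) {C : Contour}
    (hC : Admissible r σ τ (tilde r σ τ X) C) :
    (psiMatrix r σ τ C n X).det = lam r σ τ ^ n / (2 ^ n * (Nat.factorial n : ℂ)) *
      ∑ k : Fin n → Fin r, ∫ t in Set.univ.pi (fun _ : Fin n => Set.Icc (0 : ℝ) 1),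
        (Matrix.of fun i l : Fin n => thetaRow r σ τ n (tilde r σ τ X) 0 3 i (C.toFun (t l))
          (discVar r (tilde r σ τ X).2 (k l))).det *
        (Matrix.of fun i l : Fin n => thetaRow r σ τ n (tilde r σ τ X) 1 2 i (C.toFun (t l))
          (discVar r (tilde r σ τ X).2 (k l))).det *
        ∏ l, (integrand r σ τ (tilde r σ τ X) (C.toFun (t l))
          (discVar r (tilde r σ τ X).2 (k l)) * deriv C.toFun (t l)) := by
  have h := det_sum_integral (n := n) (κ := Fin r) (ν := volume.restrict (Set.Icc (0 : ℝ) 1))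
    (fun i k t => thetaRow r σ τ n (tilde r σ τ X) 0 3 i (C.toFun t)
      (discVar r (tilde r σ τ X).2 k))
    (fun i k t => thetaRow r σ τ n (tilde r σ τ X) 1 2 i (C.toFun t)
      (discVar r (tilde r σ τ X).2 k))
    (fun k t => integrand r σ τ (tilde r σ τ X) (C.toFun t)
      (discVar r (tilde r σ τ X).2 k) * deriv C.toFun t)
    (fun i j k => integrableOn_thetaRow_integrand hr hσ hτ n hX hC i j k.2)
  have hM : psiMatrix r σ τ C n X = (lam r σ τ / 2) • Matrix.of fun i j : Fin n =>
      ∑ k : Fin r, ∫ t in Set.Icc (0 : ℝ) 1,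
      thetaRow r σ τ n (tilde r σ τ X) 0 3 i (C.toFun t) (discVar r (tilde r σ τ X).2 k) *
      thetaRow r σ τ n (tilde r σ τ X) 1 2 j (C.toFun t) (discVar r (tilde r σ τ X).2 k) *
      (integrand r σ τ (tilde r σ τ X) (C.toFun t) (discVar r (tilde r σ τ X).2 k) *
        deriv C.toFun t) := by
    ext i j
    rw [psiMatrix_apply hr hσ hτ n hX, Matrix.smul_apply, Matrix.of_apply, smul_eq_mul]
  rw [hM, Matrix.det_smul, h, Fintype.card_fin, ← mul_assoc, volume_pi, Measure.restrict_pi_pi]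
  congr 1
  rw [div_pow]
  field_simp

end PsiMatrix

/-! ### Triangular products -/

section Triangle

variable {M : Type*} [CommMonoid M]

theorem prod_triangle_comm (n : ℕ) (f : ℕ → ℕ → M) :
    ∏ a ∈ Finset.range n, ∏ b ∈ Finset.range (n - 1 - a), f a b
      = ∏ b ∈ Finset.range n, ∏ a ∈ Finset.range (n - 1 - b), f a b := by
  refine Finset.prod_comm' fun a b => ?_
  simp only [Finset.mem_range]
  omega

theorem prod_prod_range_reflect (n : ℕ) (f : ℕ → M) :
    ∏ i ∈ Finset.range n, ∏ j ∈ Finset.range i, f j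
      = ∏ a ∈ Finset.range n, ∏ b ∈ Finset.range (n - 1 - a), f b :=
  (Finset.prod_range_reflect (fun i => ∏ j ∈ Finset.range i, f j) n).symm

theorem prod_filter_lt_const (n : ℕ) (c : M) :
    ∏ _p ∈ Finset.univ.filter (fun p : Fin n × Fin n => p.1 < p.2), c
      = ∏ a ∈ Finset.range n, ∏ _b ∈ Finset.range (n - 1 - a), c := by
  induction n with
  | zero => simp
  | succ n ih => rw [prod_triangle_succ n fun _ _ => c, prod_filter_lt_succ n fun _ _ => c, ih]

/-- Each index lies in n - 1 of the pairs. -/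
theorem prod_filter_lt_mul (n : ℕ) (f : Fin n → M) :
    ∏ p ∈ Finset.univ.filter (fun p : Fin n × Fin n => p.1 < p.2), (f p.1 * f p.2)
      = ∏ l, f l ^ (n - 1) := by
  induction n with
  | zero => simp
  | succ n ih =>
    rw [prod_filter_lt_succ n fun i j => f i * f j, ih fun i => f i.castSucc,
      Finset.prod_mul_distrib, Fin.prod_univ_castSucc, Finset.prod_const, Finset.card_fin,
      mul_right_comm, Nat.add_sub_cancel, ← Finset.prod_mul_distrib]
    congr 1
    refine Finset.prod_congr rfl fun i _ => ?_
    rw [← pow_succ']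
    congr 1
    have := i.2
    omega

theorem prod_triangle_exp_const (n : ℕ) (c : ℂ) :
    ∏ a ∈ Finset.range n, ∏ _b ∈ Finset.range (n - 1 - a), Complex.exp c
      = Complex.exp (c * (n.choose 2 : ℂ)) := by
  induction n with
  | zero => simp
  | succ n ih =>
    rw [prod_triangle_succ n fun _ _ => Complex.exp c, ih, Finset.prod_const, Finset.card_fin,
      ← Complex.exp_nat_mul, ← Complex.exp_add, Nat.choose_succ_succ, Nat.choose_one_right]
    congr 1
    push_cast
    ring

/-- The sum of b over the triangle is C(n, 3), which explains that exponent in d^{(n)}. -/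
theorem prod_triangle_exp_mul (n : ℕ) (c : ℂ) :
    ∏ a ∈ Finset.range n, ∏ b ∈ Finset.range (n - 1 - a), Complex.exp (c * (b : ℂ))
      = Complex.exp (c * (n.choose 3 : ℂ)) := by
  induction n with
  | zero => simp
  | succ n ih =>
    rw [prod_triangle_succ n fun _ b => Complex.exp (c * (b : ℂ)), ih, ← Complex.exp_sum,
      ← Finset.mul_sum, ← Complex.exp_add, Nat.choose_succ_succ, ← mul_add]
    have h : ∑ i : Fin n, ((i : ℕ) : ℂ) = (n.choose 2 : ℂ) := by
      rw [← Finset.sum_range (fun i => (i : ℂ)), ← Nat.cast_sum, Finset.sum_range_id,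
        Nat.choose_two_right]
    rw [h]
    push_cast
    rfl

end Triangle

/-! ### Products of two lens theta functions -/

section Pair

variable {r : ℕ} {σ τ : ℂ}

/-- The constant part of `φ_σ`. -/
def phiConst (r : ℕ) (σ τ : ℂ) : ℂ :=
  -(Real.pi * Complex.I) / (6 * r) * (-3 * (r - 1) - ((r : ℂ) ^ 2 - 1) * (σ - τ - 1))

/-- The exponent that belongs to the first variable in `θ_σ(x ± z, 𝐱 ± s)`. -/
def pairExpFst (r : ℕ) (σ τ x : ℂ) (s : ℚ) : ℂ :=
  2 * Real.pi * Complex.I / r * (x * (1 + 2 * s) + s ^ 2 * (σ - 1) - s)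
    + 2 * Real.pi * Complex.I * s + 2 * phiConst r σ τ

/-- The exponent that belongs to the second variable in `θ_σ(x ± z, 𝐱 ± s)`. -/
def pairExpSnd (r : ℕ) (σ z : ℂ) (s : ℚ) : ℂ :=
  2 * Real.pi * Complex.I / r * (2 * s * z + s ^ 2 * (σ - 1))

/-- The exponent φ_σ is quadratic, so by the parallelogram law the mixed terms cancel and the sum
splits into a part in (x, s) and a part in (z, t). -/
theorem lensTheta_mul_lensTheta (hr : 0 < r) (σ τ x z : ℂ) (s t : ℚ) :
    lensTheta r σ τ (x + z) (s + t) * lensTheta r σ τ (x - z) (s - t)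
      = Complex.exp (pairExpFst r σ τ x s) * Complex.exp (pairExpSnd r σ z t) *
        thetaPair (σ * r) (x + σ * s) (z + σ * t) := by
  have hr0 : (r : ℂ) ≠ 0 := by exact_mod_cast hr.ne'
  have h1 : e (x + z) * e (σ * ((s + t : ℚ) : ℂ)) = e (x + σ * s + (z + σ * t)) := by
    rw [← e_add]; congr 1; push_cast; ring
  have h2 : e (x - z) * e (σ * ((s - t : ℚ) : ℂ)) = e (x + σ * s - (z + σ * t)) := by
    rw [← e_add]; congr 1; push_cast; ring
  have h3 : Complex.exp (phiSigma r σ τ (x + z) (s + t)) *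
      Complex.exp (phiSigma r σ τ (x - z) (s - t))
      = Complex.exp (pairExpFst r σ τ x s) * Complex.exp (pairExpSnd r σ z t) *
        e (-(x + σ * s)) := by
    rw [e, ← Complex.exp_add, ← Complex.exp_add, ← Complex.exp_add]
    congr 1
    rw [phiSigma, phiSigma, pairExpFst, pairExpSnd, phiConst]
    push_cast
    field_simp
    ring
  rw [lensTheta, lensTheta, h1, h2, thetaPair, mul_mul_mul_comm, h3]
  ring

/-- The four signs are grouped as z ± w and -z ± w. Since `thetaPair` is even in its first variable,
the theta part is a perfect square. -/
theorem prod_signs_lensTheta (hr : 0 < r) (hσ : 0 < σ.im) (τ z w : ℂ) (s t : ℚ) :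
    ∏ ε : ℤˣ, ∏ δ : ℤˣ, lensTheta r σ τ ((ε : ℤ) * z + (δ : ℤ) * w) ((ε : ℤ) * s + (δ : ℤ) * t)
      = Complex.exp (4 * phiConst r σ τ) *
        (Complex.exp (pairExpSnd r σ z s) ^ 2 * Complex.exp (pairExpSnd r σ w t) ^ 2) *
        thetaPair (σ * r) (z + σ * s) (w + σ * t) ^ 2 := by
  have hr0 : (r : ℂ) ≠ 0 := by exact_mod_cast hr.ne'
  have hu : (Finset.univ : Finset ℤˣ) = {1, -1} := rfl
  have hne : (1 : ℤˣ) ≠ -1 := by decide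
  have h1 := lensTheta_mul_lensTheta hr σ τ z w s t
  have h2 := lensTheta_mul_lensTheta hr σ τ (-z) w (-s) t
  rw [show -z + σ * ((-s : ℚ) : ℂ) = -(z + σ * s) by push_cast; ring,
    thetaPair_neg_left (im_mul_nat_pos hr hσ)] at h2
  have h3 : Complex.exp (pairExpFst r σ τ z s) * Complex.exp (pairExpFst r σ τ (-z) (-s))
      = Complex.exp (4 * phiConst r σ τ) * Complex.exp (pairExpSnd r σ z s) ^ 2 := by
    rw [← Complex.exp_nat_mul, ← Complex.exp_add, ← Complex.exp_add]
    congr 1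
    rw [pairExpFst, pairExpFst, pairExpSnd]
    push_cast
    ring
  rw [hu, Finset.prod_pair hne, Finset.prod_pair hne, Finset.prod_pair hne]
  simp only [Units.val_one, Units.val_neg, Int.cast_one, Int.cast_neg, one_mul, neg_mul,
    ← sub_eq_add_neg]
  rw [h1, h2]
  linear_combination (Complex.exp (pairExpSnd r σ w t) ^ 2 *
    thetaPair (σ * r) (z + σ * s) (w + σ * t) ^ 2) * h3

/-- The continuous variable `x_j + mτ + σ(𝐱_j + m)` of the theta functions. -/
def lensPoint (σ τ : ℂ) (Y : Point) (j : Fin 8) (m : ℕ) : ℂ :=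
  Y.1 j + m * τ + σ * ((Y.2 j + m : ℚ) : ℂ)

/-- The exponent attached to the shifted variable `x_j + mT`. -/
def lensExp (r : ℕ) (σ τ : ℂ) (Y : Point) (j : Fin 8) (m : ℕ) : ℂ :=
  pairExpFst r σ τ (Y.1 j + m * τ) (Y.2 j + m)

theorem thetaPochPair_eq (hr : 0 < r) (σ τ : ℂ) (Y : Point) (j : Fin 8) (c : ℕ) (z : ℂ) (s : ℚ) :
    thetaPochPair r σ τ Y j c z s = (∏ m ∈ Finset.range c, Complex.exp (lensExp r σ τ Y j m)) *
      Complex.exp (pairExpSnd r σ z s) ^ c *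
      ∏ m ∈ Finset.range c, thetaPair (σ * r) (lensPoint σ τ Y j m) (z + σ * s) := by
  rw [thetaPochPair, lensThetaPoch, lensThetaPoch, ← Finset.prod_mul_distrib,
    ← Finset.card_range c, ← Finset.prod_const, Finset.card_range, ← Finset.prod_mul_distrib,
    ← Finset.prod_mul_distrib]
  refine Finset.prod_congr rfl fun m _ => ?_
  rw [lensExp, lensPoint, ← lensTheta_mul_lensTheta hr]
  congr 2 <;> ring

/-- Every entry has n - 1 theta pairs in all, so the exponential in z_l is a column factor. The
exponentials in the parameters are row factors, and `wedgeMatrix` remains. -/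
theorem det_thetaRow (hr : 0 < r) (hσ : 0 < σ.im) (τ : ℂ) (n : ℕ) (Y : Point) (a b : Fin 8)
    (z : Fin n → ℂ) (s : Fin n → ℚ) :
    (Matrix.of fun i l : Fin n => thetaRow r σ τ n Y a b i (z l) (s l)).det
      = (∏ i ∈ Finset.range n, ∏ j ∈ Finset.range (n - 1 - i),
          (Complex.exp (lensExp r σ τ Y a i) * Complex.exp (lensExp r σ τ Y b j) *
            thetaPair (σ * r) (lensPoint σ τ Y a i) (lensPoint σ τ Y b j))) *
        (∏ l, Complex.exp (pairExpSnd r σ (z l) (s l)) ^ (n - 1)) *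
        ∏ p ∈ Finset.univ.filter (fun p : Fin n × Fin n => p.1 < p.2),
          thetaPair (σ * r) (z p.1 + σ * s p.1) (z p.2 + σ * s p.2) := by
  have hw : ∀ u v, thetaPair (σ * r) u v = wedge (thetaVec (σ * r) u) (thetaVec (σ * r) v) :=
    thetaPair_eq_wedge (im_mul_nat_pos hr hσ)
  have hM : (Matrix.of fun i l : Fin n => thetaRow r σ τ n Y a b i (z l) (s l))
      = Matrix.of fun i l : Fin n =>
        ((∏ m ∈ Finset.range (n - 1 - i), Complex.exp (lensExp r σ τ Y a m)) *
          ∏ m ∈ Finset.range i, Complex.exp (lensExp r σ τ Y b m)) *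
        Matrix.of (fun i l : Fin n => Complex.exp (pairExpSnd r σ (z l) (s l)) ^ (n - 1) *
          wedgeMatrix n (fun m => thetaVec (σ * r) (lensPoint σ τ Y a m))
            (fun m => thetaVec (σ * r) (lensPoint σ τ Y b m))
            (fun l => thetaVec (σ * r) (z l + σ * s l)) i l) i l := by
    ext i l
    have hi : n - 1 = n - 1 - i + i := by have := i.2; omega
    simp only [Matrix.of_apply, wedgeMatrix, thetaRow, thetaPochPair_eq hr, hw]
    conv_rhs => rw [hi, pow_add, ← hi]
    ring
  rw [hM, Matrix.det_mul_column, Matrix.det_mul_row, det_wedgeMatrix, wedgeVandermonde]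
  simp only [← hw, Finset.prod_mul_distrib]
  rw [← Finset.prod_range fun i => ∏ m ∈ Finset.range (n - 1 - i), Complex.exp (lensExp r σ τ Y a m),
    ← Finset.prod_range fun i => ∏ m ∈ Finset.range i, Complex.exp (lensExp r σ τ Y b m),
    prod_prod_range_reflect,
    prod_triangle_comm n fun _ m => Complex.exp (lensExp r σ τ Y a m)]
  ring

end Pair

/-! ### Evaluation of the theta determinants -/

section Evaluation

variable {r : ℕ} {σ τ : ℂ}

theorem prod_Icc_one {M : Type*} [CommMonoid M] (n : ℕ) (f : ℕ → M) :
    ∏ k ∈ Finset.Icc 1 n, f k = ∏ i ∈ Finset.range n, f (i + 1) := by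
  rw [show Finset.Icc 1 n = Finset.Ico 1 (n + 1) by ext k; simp only [Finset.mem_Icc, Finset.mem_Ico]; omega,
    Finset.prod_Ico_eq_prod_range]
  simp only [Nat.add_sub_cancel, add_comm]

theorem prod_lensThetaPoch_pred (n : ℕ) (u : ℂ) (s : ℚ) :
    ∏ k ∈ Finset.Icc 1 n, lensThetaPoch r σ τ (u + (1 - n) * τ) (s + (1 - n)) (k - 1)
      = ∏ a ∈ Finset.range n, ∏ b ∈ Finset.range (n - 1 - a),
        lensTheta r σ τ (u - (a + b + 1) * τ) (s - (a + b + 1)) := by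
  rw [prod_Icc_one]
  simp only [Nat.add_sub_cancel, lensThetaPoch]
  rw [prod_prod_range_reflect]
  refine Finset.prod_congr rfl fun a ha => ?_
  rw [← Finset.prod_range_reflect]
  refine Finset.prod_congr rfl fun b hb => ?_
  rw [Finset.mem_range] at ha hb
  have h : n = n - 1 - a - 1 - b + (a + b + 2) := by omega
  have h1 : ((n - 1 - a - 1 - b : ℕ) : ℂ) = n - (a + b + 2) := by
    rw [eq_sub_iff_add_eq]; exact_mod_cast h.symm
  have h2 : ((n - 1 - a - 1 - b : ℕ) : ℚ) = n - (a + b + 2) := by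
    rw [eq_sub_iff_add_eq]; exact_mod_cast h.symm
  rw [h1, h2]
  congr 1 <;> ring

theorem prod_lensThetaPoch_sub (n : ℕ) (u : ℂ) (s : ℚ) :
    ∏ k ∈ Finset.Icc 1 n, lensThetaPoch r σ τ (u - (k - 1) * τ) (s - (k - 1)) (n - k)
      = ∏ a ∈ Finset.range n, ∏ b ∈ Finset.range (n - 1 - a),
        lensTheta r σ τ (u + (a - b) * τ) (s + (a - b)) := by
  rw [prod_Icc_one, prod_triangle_comm]
  refine Finset.prod_congr rfl fun b _ => ?_
  rw [lensThetaPoch, show n - (b + 1) = n - 1 - b by omega]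
  refine Finset.prod_congr rfl fun a _ => ?_
  push_cast
  congr 1 <;> ring

/-- The triangular form matches the one produced by `det_thetaRow`, so the two can be compared one
(a, b) at a time. -/
theorem dFun_eq (r : ℕ) (σ τ : ℂ) (n : ℕ) (X : Point) :
    dFun r σ τ n X = ∏ a ∈ Finset.range n, ∏ b ∈ Finset.range (n - 1 - a),
      (Complex.exp (4 * Real.pi * Complex.I / r * (τ - 1) * (b : ℂ)) *
        Complex.exp (2 * Real.pi * Complex.I / r * (σ + τ - X.1 0 - X.1 1 + X.2 0 + X.2 1)) *
        (lensTheta r σ τ (X.1 0 + X.1 3 - (a + b + 1) * τ) (X.2 0 + X.2 3 - (a + b + 1)) *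
          lensTheta r σ τ (X.1 1 + X.1 2 - (a + b + 1) * τ) (X.2 1 + X.2 2 - (a + b + 1)) *
          lensTheta r σ τ (X.1 0 - X.1 3 + (a - b) * τ) (X.2 0 - X.2 3 + (a - b)) *
          lensTheta r σ τ (X.1 1 - X.1 2 + (a - b) * τ) (X.2 1 - X.2 2 + (a - b)))) := by
  simp only [dFun, Finset.prod_mul_distrib, prod_lensThetaPoch_pred, prod_lensThetaPoch_sub,
    prod_triangle_exp_const, prod_triangle_exp_mul]

theorem theta_e_sub (κ u : ℂ) : theta (e (κ - u)) (e κ) = theta (e u) (e κ) := by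
  rw [e_sub, theta_base_div (e_ne_zero _) (e_ne_zero _)]

/-- The transform keeps x_p - x_q and sends x_p + x_q to σ + τ - x_{p'} - x_{q'} for the
complementary pair. The reflection is undone by θ(q/z) = θ(z). The hypothesis `hX` is needed in ℂ
and in ℚ, hence for every M. -/
theorem thetaPair_lensPoint_tilde (X : Point) {p q p' q' : Fin 8} (hp : p < 4) (hq : q < 4)
    (hX : ∀ {M : Type} [AddCommGroup M] (f : Fin 8 → M), f 0 + f 1 + f 2 + f 3
      = f p + f q + (f p' + f q')) (a b : ℕ) :
    thetaPair (σ * r) (lensPoint σ τ (tilde r σ τ X) p a) (lensPoint σ τ (tilde r σ τ X) q b)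
      = e (-lensPoint σ τ (tilde r σ τ X) p a) *
        (theta (e (X.1 p' + X.1 q' - (a + b + 1) * τ) *
            e (σ * ((X.2 p' + X.2 q' - (a + b + 1) : ℚ) : ℂ))) (e (σ * r)) *
          theta (e (X.1 p - X.1 q + (a - b) * τ) *
            e (σ * ((X.2 p - X.2 q + (a - b) : ℚ) : ℂ))) (e (σ * r))) := by
  rw [thetaPair, ← e_add, ← e_add, ← theta_e_sub (σ * r) (X.1 p' + X.1 q' - (a + b + 1) * τ + _)]
  simp only [lensPoint, tilde, sum_block_zero _ hp, sum_block_zero _ hq, hX]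
  congr 4
  · push_cast
    ring
  · push_cast
    ring

/-- The pair {0,3} yields θ(x_1 + x_2) and θ(x_0 - x_3), the pair {1,2} the other two, so both are
needed to form a factor of d^{(n)}. The exponents agree only modulo 2πi, which uses that 𝐱_0 + 𝐱_1
is an integer. -/
theorem pair_identity (hr : 0 < r) (X : Point) {N : ℤ} (hN : X.2 0 + X.2 1 = N) (a b : ℕ) :
    (Complex.exp (lensExp r σ τ (tilde r σ τ X) 0 a) *
        Complex.exp (lensExp r σ τ (tilde r σ τ X) 3 b) *
        thetaPair (σ * r) (lensPoint σ τ (tilde r σ τ X) 0 a)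
          (lensPoint σ τ (tilde r σ τ X) 3 b)) *
      (Complex.exp (lensExp r σ τ (tilde r σ τ X) 1 a) *
        Complex.exp (lensExp r σ τ (tilde r σ τ X) 2 b) *
        thetaPair (σ * r) (lensPoint σ τ (tilde r σ τ X) 1 a)
          (lensPoint σ τ (tilde r σ τ X) 2 b))
      = Complex.exp (4 * phiConst r σ τ) *
        (Complex.exp (4 * Real.pi * Complex.I / r * (τ - 1) * (b : ℂ)) *
        Complex.exp (2 * Real.pi * Complex.I / r * (σ + τ - X.1 0 - X.1 1 + X.2 0 + X.2 1)) *
        (lensTheta r σ τ (X.1 0 + X.1 3 - (a + b + 1) * τ) (X.2 0 + X.2 3 - (a + b + 1)) *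
          lensTheta r σ τ (X.1 1 + X.1 2 - (a + b + 1) * τ) (X.2 1 + X.2 2 - (a + b + 1)) *
          lensTheta r σ τ (X.1 0 - X.1 3 + (a - b) * τ) (X.2 0 - X.2 3 + (a - b)) *
          lensTheta r σ τ (X.1 1 - X.1 2 + (a - b) * τ) (X.2 1 - X.2 2 + (a - b)))) := by
  have hr0 : (r : ℂ) ≠ 0 := by exact_mod_cast hr.ne'
  have h1 := thetaPair_lensPoint_tilde (r := r) (σ := σ) (τ := τ) X (p := 0) (q := 3) (p' := 1)
    (q' := 2) (by decide) (by decide) (fun f => by abel) a b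
  have h2 := thetaPair_lensPoint_tilde (r := r) (σ := σ) (τ := τ) X (p := 1) (q := 2) (p' := 0)
    (q' := 3) (by decide) (by decide) (fun f => by abel) a b
  have hN' : (X.2 0 : ℂ) + X.2 1 = N := by exact_mod_cast congrArg (Rat.cast : ℚ → ℂ) hN
  have hexp : Complex.exp (lensExp r σ τ (tilde r σ τ X) 0 a) *
        Complex.exp (lensExp r σ τ (tilde r σ τ X) 3 b) *
        e (-lensPoint σ τ (tilde r σ τ X) 0 a) *
      (Complex.exp (lensExp r σ τ (tilde r σ τ X) 1 a) *
        Complex.exp (lensExp r σ τ (tilde r σ τ X) 2 b) *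
        e (-lensPoint σ τ (tilde r σ τ X) 1 a))
      = Complex.exp (4 * phiConst r σ τ) *
        (Complex.exp (4 * Real.pi * Complex.I / r * (τ - 1) * (b : ℂ)) *
        Complex.exp (2 * Real.pi * Complex.I / r * (σ + τ - X.1 0 - X.1 1 + X.2 0 + X.2 1)) *
        (Complex.exp (phiSigma r σ τ (X.1 0 + X.1 3 - (a + b + 1) * τ)
            (X.2 0 + X.2 3 - (a + b + 1))) *
          Complex.exp (phiSigma r σ τ (X.1 1 + X.1 2 - (a + b + 1) * τ)
            (X.2 1 + X.2 2 - (a + b + 1))) *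
          Complex.exp (phiSigma r σ τ (X.1 0 - X.1 3 + (a - b) * τ) (X.2 0 - X.2 3 + (a - b))) *
          Complex.exp (phiSigma r σ τ (X.1 1 - X.1 2 + (a - b) * τ)
            (X.2 1 - X.2 2 + (a - b))))) := by
    simp only [e, ← Complex.exp_add]
    rw [Complex.exp_eq_exp_iff_exists_int]
    -- The difference of the two exponents in units of 2πi.
    refine ⟨r - N - 1 + 2 * b, ?_⟩
    simp only [lensExp, lensPoint, tilde, sum_block_zero _ (show (0 : Fin 8) < 4 by decide),
      sum_block_zero _ (show (1 : Fin 8) < 4 by decide),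
      sum_block_zero _ (show (2 : Fin 8) < 4 by decide),
      sum_block_zero _ (show (3 : Fin 8) < 4 by decide), pairExpFst, phiSigma, phiConst]
    push_cast
    rw [← hN']
    field_simp
    ring
  rw [h1, h2]
  simp only [lensTheta]
  linear_combination (theta (e (X.1 1 + X.1 2 - (a + b + 1) * τ) *
            e (σ * ((X.2 1 + X.2 2 - (a + b + 1) : ℚ) : ℂ))) (e (σ * r)) *
          theta (e (X.1 0 - X.1 3 + (a - b) * τ) *
            e (σ * ((X.2 0 - X.2 3 + (a - b) : ℚ) : ℂ))) (e (σ * r)) *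
          theta (e (X.1 0 + X.1 3 - (a + b + 1) * τ) *
            e (σ * ((X.2 0 + X.2 3 - (a + b + 1) : ℚ) : ℂ))) (e (σ * r)) *
          theta (e (X.1 1 - X.1 2 + (a - b) * τ) *
            e (σ * ((X.2 1 - X.2 2 + (a - b) : ℚ) : ℂ))) (e (σ * r))) * hexp

/-- Each determinant contributes one product of `thetaPair` over i < j, and the sign product is its
square. The constants exp(4 `phiConst`) match because there are as many pairs i < j as points (a, b)
in the triangle. -/
theorem det_thetaRow_mul_det_thetaRow (hr : 0 < r) (hσ : 0 < σ.im) (n : ℕ) (X : Point)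
    {N : ℤ} (hN : X.2 0 + X.2 1 = N) (z : Fin n → ℂ) (s : Fin n → ℚ) :
    (Matrix.of fun i l : Fin n => thetaRow r σ τ n (tilde r σ τ X) 0 3 i (z l) (s l)).det *
      (Matrix.of fun i l : Fin n => thetaRow r σ τ n (tilde r σ τ X) 1 2 i (z l) (s l)).det
      = dFun r σ τ n X * ∏ p ∈ Finset.univ.filter (fun p : Fin n × Fin n => p.1 < p.2),
        ∏ ε : ℤˣ, ∏ δ : ℤˣ, lensTheta r σ τ ((ε : ℤ) * z p.1 + (δ : ℤ) * z p.2)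
          ((ε : ℤ) * s p.1 + (δ : ℤ) * s p.2) := by
  have hd : dFun r σ τ n X * (∏ _p ∈ Finset.univ.filter (fun p : Fin n × Fin n => p.1 < p.2),
      Complex.exp (4 * phiConst r σ τ))
      = (∏ a ∈ Finset.range n, ∏ b ∈ Finset.range (n - 1 - a),
        (Complex.exp (lensExp r σ τ (tilde r σ τ X) 0 a) *
          Complex.exp (lensExp r σ τ (tilde r σ τ X) 3 b) *
          thetaPair (σ * r) (lensPoint σ τ (tilde r σ τ X) 0 a)
            (lensPoint σ τ (tilde r σ τ X) 3 b))) *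
        ∏ a ∈ Finset.range n, ∏ b ∈ Finset.range (n - 1 - a),
        (Complex.exp (lensExp r σ τ (tilde r σ τ X) 1 a) *
          Complex.exp (lensExp r σ τ (tilde r σ τ X) 2 b) *
          thetaPair (σ * r) (lensPoint σ τ (tilde r σ τ X) 1 a)
            (lensPoint σ τ (tilde r σ τ X) 2 b)) := by
    rw [dFun_eq, prod_filter_lt_const, mul_comm, ← Finset.prod_mul_distrib,
      ← Finset.prod_mul_distrib]
    refine Finset.prod_congr rfl fun a _ => ?_
    rw [← Finset.prod_mul_distrib, ← Finset.prod_mul_distrib]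
    exact Finset.prod_congr rfl fun b _ => (pair_identity hr X hN a b).symm
  have hs : ∏ p ∈ Finset.univ.filter (fun p : Fin n × Fin n => p.1 < p.2),
        ∏ ε : ℤˣ, ∏ δ : ℤˣ, lensTheta r σ τ ((ε : ℤ) * z p.1 + (δ : ℤ) * z p.2)
          ((ε : ℤ) * s p.1 + (δ : ℤ) * s p.2)
      = (∏ _p ∈ Finset.univ.filter (fun p : Fin n × Fin n => p.1 < p.2),
          Complex.exp (4 * phiConst r σ τ)) *
        (∏ l, Complex.exp (pairExpSnd r σ (z l) (s l)) ^ (n - 1)) ^ 2 *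
        (∏ p ∈ Finset.univ.filter (fun p : Fin n × Fin n => p.1 < p.2),
          thetaPair (σ * r) (z p.1 + σ * s p.1) (z p.2 + σ * s p.2)) ^ 2 := by
    rw [← Finset.prod_pow, ← Finset.prod_pow]
    simp only [pow_right_comm _ (n - 1) 2]
    rw [← prod_filter_lt_mul n fun l => Complex.exp (pairExpSnd r σ (z l) (s l)) ^ 2,
      ← Finset.prod_mul_distrib, ← Finset.prod_mul_distrib]
    exact Finset.prod_congr rfl fun p _ => prod_signs_lensTheta hr hσ τ _ _ _ _
  rw [hs, ← mul_assoc, ← mul_assoc, hd, det_thetaRow hr hσ, det_thetaRow hr hσ]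
  ring

end Evaluation

end LensTau

end

/-! ### Assembly of the determinant formula. -/

theorem theorem5p4 (r : ℕ) (hr : 0 < r) (σ τ μ : ℂ)
    (hσ : 0 < σ.im) (hτ : 0 < τ.im) (hμ : 0 < μ.im)
    (n : ℕ) (X : LensTau.Point) (hX : X ∈ LensTau.domainD r σ τ n)
    (hd : LensTau.dFun r σ τ n X ≠ 0)
    (C : LensTau.Contour) (hC : LensTau.Admissible r σ τ (LensTau.tilde r σ τ X) C) :
    (∀ i ∈ Finset.Icc 1 n, ∀ j ∈ Finset.Icc 1 n,
      LensTau.shiftT τ X (LensTau.frameShift n i j) ∈ LensTau.domainD r σ τ 1 ∧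
      LensTau.Admissible r σ τ
        (LensTau.tilde r σ τ (LensTau.shiftT τ X (LensTau.frameShift n i j))) C) ∧
    LensTau.tauFun r σ τ μ C n X
      = LensTau.gFun r σ τ μ n X * LensTau.dFun r σ τ n X * LensTau.multiIntegral r σ τ C n X ∧
    LensTau.gFun r σ τ μ n X * LensTau.dFun r σ τ n X * LensTau.multiIntegral r σ τ C n X
      = LensTau.eFun r σ τ n X * LensTau.calG r σ τ μ n X *
          LensTau.multiIntegral r σ τ C n X := by
  refine ⟨fun i hi j hj => ⟨LensTau.shiftT_mem_domainD hX i j, ?_⟩, ?_, ?_⟩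
  · rw [LensTau.tilde_shiftT r σ τ X hi hj]
    exact hC.shiftNat hr _
  · obtain ⟨a, b, hab⟩ := LensTau.exists_int_tilde hX
    obtain ⟨a', b', hab'⟩ := LensTau.exists_int_of_mem_latticeE8 hX.2.2
    have hN : X.2 0 + X.2 1 = (a' 0 + a' 1 + b' : ℤ) := by
      rw [hab', hab']; push_cast; ring
    -- The identity before normalisation: the integrands agree pointwise after d^{(n)} is pulled
    -- inside.
    have h : (LensTau.psiMatrix r σ τ C n X).det
        = LensTau.dFun r σ τ n X * LensTau.multiIntegral r σ τ C n X := by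
      rw [LensTau.det_psiMatrix hr hσ hτ n hab hC, LensTau.multiIntegral, mul_left_comm]
      congr 1
      rw [Finset.mul_sum]
      refine Finset.sum_congr rfl fun k _ => ?_
      rw [← MeasureTheory.integral_const_mul]
      congr 1
      funext t
      rw [LensTau.det_thetaRow_mul_det_thetaRow hr hσ n X hN (fun l => C.toFun (t l))
        (fun l => LensTau.discVar r (LensTau.tilde r σ τ X).2 (k l)), mul_assoc]
    rw [mul_assoc, ← h]
    -- The cast of n to ℤ is `Int.ofNat n`, so `tauFun` unfolds to its first branch.
    rfl
  · rw [LensTau.gFun]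
    -- Cancels d^{(n)}(X), which is nonzero by `hd`.
    field_simp
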